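/- Let $d\ge 1$, let $\Omega\subset\mathbb{R}^d$ be open and let $\rho:\Omega\to(0,\infty)$ be locally Lipschitz. Let $\Omega_1,\dots,\Omega_C\subset\Omega$ be sets (the classes) and put $\Omega'=\bigcup_{i=1}^C\Omega_i$ and $\mathcal{S}=\min_{i\ne j}\operatorname{dist}(\Omega_i,\Omega_j)$ (with $\mathcal S=\infty$ if $C=1$). Let $\mathcal{L}_i\subset\Omega_i$ be finite sets (the labels), $\mathcal{L}=\bigcup_{i=1}^C\mathcal{L}_i$. Let $\tau\ge 0$, $\alpha>d-2$ and $\gamma(x)=1+\operatorname{dist}(x,\mathcal{L})^{-\alpha}$. For each $i$ let $u_i$ be a solution of \[ \tau u_i-\rho^{-1}\operatorname{div}(\gamma\rho^2\nabla u_i)=0\ \text{ in }\Omega\setminus\mathcal{L},\qquad u_i=1\ \text{ on }\mathcal{L}_i,\qquad u_i=0\ \text{ on }\mathcal{L}\setminus\mathcal{L}_i, \] with homogeneous Neumann condition on $\partial\Omega$, in the following weak sense: $u_i$ is continuous on $\Omega$, takes the prescribed values on $\mathcal{L}$, has a weak gradient on $\Omega\setminus\mathcal L$ with $\int_{\Omega\setminus\mathcal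 L}(\gamma\rho^2|\nabla u_i|^2+\rho u_i^2)\,dx<\infty$, and $\int_{\Omega\setminus\mathcal L}(\gamma\rho^2\nabla u_i\cdot\nabla v+\tau\rho u_iv)\,dx=0$ for every $v$ with $\int_{\Omega\setminus\mathcal L}(\gamma\rho^2|\nabla v|^2+\rho v^2)\,dx<\infty$ that vanishes in a neighborhood of $\mathcal{L}$. Let $\mathcal{A}=\sqrt{u_1^2+\dots+u_C^2}$, and write $B_s$ for the open ball of radius $s$ centered at the origin. Let $r>0$ be such that $\Omega'+B_{2r}\subset\Omega$, $r\le\frac14\mathcal{S}$ (if $d=1$, assume moreover $r\le\frac12$; for $d\ge2$ this follows from the last condition below), \[ \tau r^d\le\frac{1}{2^d\,9}(\alpha+2-d)^2\inf_{\Omega'+B_{2r}}\rho, \] and \[ 4\|\nabla\log\rho\|_{L^\infty(\Omega'+B_{2r})}(1+2^\alpha r^\alpha)r+\alpha2^\alpha r^\alpha\le\tfrac14(\alpha+2-d). \] Then \[ \inf_{\mathcal{L}+B_r}\mathcal{A}\ge 1-2^{-\frac12(\alpha+2-d)}. \] -/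

import Mathlib

open MeasureTheory Set
open scoped Pointwise ContDiff Gradient ENNReal

noncomputable section

namespace ActiveLearning

/-- The distance `inf {|x - y| : x ∈ A, y ∈ B}` between two sets (`∞` if one of them is empty). -/
def setDist {d : ℕ} (A B : Set (EuclideanSpace ℝ (Fin d))) : ℝ≥0∞ :=
  ⨅ x ∈ A, ⨅ y ∈ B, edist x y

/-- The separation `min_{i ≠ j} dist(Ω_i, Ω_j)` of the classes (`∞` if there is only one class). -/
def separation {d C : ℕ} (cls : Fin C → Set (EuclideanSpace ℝ (Fin d))) : ℝ≥0∞ :=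
  ⨅ i, ⨅ j, ⨅ _ : i ≠ j, setDist (cls i) (cls j)

/-- The singular weight `γ(x) = 1 + dist(x, L)^(-α)`. -/
def weight {d : ℕ} (α : ℝ) (L : Set (EuclideanSpace ℝ (Fin d)))
    (x : EuclideanSpace ℝ (Fin d)) : ℝ :=
  1 + Metric.infDist x L ^ (-α)

/-- `g` is the weak (distributional) gradient of `u` on the open set `U`. -/
structure HasWeakGradientOn {d : ℕ} (u : EuclideanSpace ℝ (Fin d) → ℝ)
    (g : EuclideanSpace ℝ (Fin d) → EuclideanSpace ℝ (Fin d))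
    (U : Set (EuclideanSpace ℝ (Fin d))) : Prop where
  locallyIntegrable : LocallyIntegrableOn u U
  locallyIntegrable_grad : LocallyIntegrableOn g U
  integral_eq : ∀ ψ : EuclideanSpace ℝ (Fin d) → ℝ, ContDiff ℝ ∞ ψ → HasCompactSupport ψ →
    tsupport ψ ⊆ U → ∀ e : EuclideanSpace ℝ (Fin d),
      ∫ x in U, u x * fderiv ℝ ψ x e = -∫ x in U, ψ x * inner ℝ (g x) e

/-- `u`, with weak gradient `g` on `U`, belongs to the weighted Sobolev space of the energy
`∫ γ ρ² |∇u|² + ρ u²`. -/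
structure MemEnergySpace {d : ℕ} (γ ρ : EuclideanSpace ℝ (Fin d) → ℝ)
    (U : Set (EuclideanSpace ℝ (Fin d))) (u : EuclideanSpace ℝ (Fin d) → ℝ)
    (g : EuclideanSpace ℝ (Fin d) → EuclideanSpace ℝ (Fin d)) : Prop where
  hasWeakGradient : HasWeakGradientOn u g U
  integrable_sq : IntegrableOn (fun x => ρ x * u x ^ 2) U
  integrable_grad_sq : IntegrableOn (fun x => γ x * ρ x ^ 2 * ‖g x‖ ^ 2) U

/-- `u` is a solution, continuous on `Ω` and of finite energy, of
`τ u - ρ⁻¹ div(γ ρ² ∇u) = 0` in `Ω \ L`, `u = 1` on `L₁`, `u = 0` on `L \ L₁`, with the homogeneous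
Neumann condition on `∂Ω`. The equation, multiplied by `ρ`, and the Neumann condition are
expressed in weak form: the test functions `v` vanish near `L`, but need not vanish near `∂Ω`. -/
structure IsSolution {d : ℕ} (Ω : Set (EuclideanSpace ℝ (Fin d)))
    (L L₁ : Set (EuclideanSpace ℝ (Fin d))) (τ α : ℝ) (ρ : EuclideanSpace ℝ (Fin d) → ℝ)
    (u : EuclideanSpace ℝ (Fin d) → ℝ) : Prop where
  continuousOn : ContinuousOn u Ω
  eq_one : ∀ z ∈ L₁, u z = 1
  eq_zero : ∀ z ∈ L \ L₁, u z = 0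
  weak : ∃ g : EuclideanSpace ℝ (Fin d) → EuclideanSpace ℝ (Fin d),
    MemEnergySpace (weight α L) ρ (Ω \ L) u g ∧
    ∀ (v : EuclideanSpace ℝ (Fin d) → ℝ)
      (h : EuclideanSpace ℝ (Fin d) → EuclideanSpace ℝ (Fin d)),
      MemEnergySpace (weight α L) ρ (Ω \ L) v h →
      (∀ z ∈ L, ∀ᶠ x in nhds z, v x = 0) →
      τ * (∫ x in Ω \ L, ρ x * u x * v x)
        + ∫ x in Ω \ L, weight α L x * ρ x ^ 2 * inner ℝ (g x) (h x) = 0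

/-- The acquisition function `𝒜 = √(u₁² + ⋯ + u_C²)`. -/
def acquisition {d C : ℕ} (u : Fin C → EuclideanSpace ℝ (Fin d) → ℝ)
    (x : EuclideanSpace ℝ (Fin d)) : ℝ :=
  √(∑ i, u i x ^ 2)

end ActiveLearning

end

noncomputable section

namespace ActiveLearning

open Filter Topology Metric

variable {d : ℕ}

local notation "𝔼" => EuclideanSpace ℝ (Fin d)

/-! ### Locally Lipschitz functions -/

section Lipschitz

variable {X Y Z : Type*} [PseudoEMetricSpace X] [PseudoEMetricSpace Y] [PseudoEMetricSpace Z]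

/-! Only the component `u i` of the class of the nearby label matters, since it bounds the
acquisition function from below. Put `R = 2r`, `β = (α+2-d)/2`. The singular part `|x|^(-α)` of the
weight admits the radial solution `|x|^(2β)`. Halving this exponent leaves a definite sign: `-|x -
z|^β` has strictly positive weighted divergence, and the smallness of `r` lets it absorb the regular
part of the weight, the drift from `∇ log ρ`, and `τ`. So `B = (R^(-β) (s^β - dist(x, Z)^β))⁺`, with
`Z = L i` and `s < R`, is a subsolution (`flux_inequality`, `barrier_subsolution`). It lies below `u
i` at every label: the separation of the classes keeps its support away from the other labels.
Comparison gives `B ≤ u i`, and `s → R` at distance below `r` gives `1 - 2^(-β)`.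

Two points need work. First, `B` has kinks where the nearest label changes and at distance `s`. They
have the favorable sign, because `B` is a maximum of radial functions and `0`. To see this weakly,
the discontinuous choice of the nearest label is replaced by softmin weights of `0` and `N(|x -
z|²)`, where `∇ N(|x - z|²)` is exactly the radial flux. Differentiating the weights then
contributes `-p` times a variance to the divergence, which has the right sign for every `p ≥ 0`
(`sum_softWeight_fderiv_nonpos`, `integral_limit_flux_ge`).

Second, admissible test functions vanish near the labels. The comparison therefore uses `G(B - u)`
with `G` zero up to `ε > 0` (`barrier_le_solution_add`). Subtracting the equation from the
subsolution inequality makes the weak gradient of `G(B - u)` vanish, so this function is locally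
constant; it is zero at a label, hence on the ball around it. Mollification supplies the chain rule
and the constancy for weak gradients. -/

theorem locallyLipschitzOn_comp {g : Y → Z} {f : X → Y} {s : Set X} {t : Set Y}
    (hg : LocallyLipschitzOn t g) (hf : LocallyLipschitzOn s f) (hst : MapsTo f s t) :
    LocallyLipschitzOn s (g ∘ f) := by
  intro x hx
  obtain ⟨Kg, v, hv, hgv⟩ := hg (hst hx)
  obtain ⟨Kf, w, hw, hfw⟩ := hf hx
  have hcont : Tendsto f (𝓝[s] x) (𝓝[t] (f x)) :=
    tendsto_nhdsWithin_of_tendsto_nhds_of_eventually_within _ (hf.continuousOn x hx)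
      (eventually_mem_nhdsWithin.mono fun y hy => hst hy)
  exact ⟨Kg * Kf, w ∩ f ⁻¹' v, inter_mem hw (hcont hv),
    hgv.comp (hfw.mono inter_subset_left) fun y hy => hy.2⟩

theorem locallyLipschitzOn_prodMk {g : X → Z} {f : X → Y} {s : Set X}
    (hf : LocallyLipschitzOn s f) (hg : LocallyLipschitzOn s g) :
    LocallyLipschitzOn s fun x => (f x, g x) := by
  intro x hx
  obtain ⟨Kg, v, hv, hgv⟩ := hg hx
  obtain ⟨Kf, w, hw, hfw⟩ := hf hx
  exact ⟨_, w ∩ v, inter_mem hw hv,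
    (hfw.mono inter_subset_left).prodMk (hgv.mono inter_subset_right)⟩

theorem _root_.ContDiffOn.locallyLipschitzOn_of_isOpen {E F : Type*} [NormedAddCommGroup E]
    [NormedSpace ℝ E] [NormedAddCommGroup F] [NormedSpace ℝ F] {f : E → F} {U : Set E}
    (hf : ContDiffOn ℝ 1 f U) (hU : IsOpen U) : LocallyLipschitzOn U f := by
  intro x hx
  obtain ⟨K, t, ht, h⟩ := (hf.contDiffAt (hU.mem_nhds hx)).exists_lipschitzOnWith
  exact ⟨K, t, mem_nhdsWithin_of_mem_nhds ht, h⟩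

theorem locallyLipschitzOn_mul {f g : X → ℝ} {s : Set X}
    (hf : LocallyLipschitzOn s f) (hg : LocallyLipschitzOn s g) :
    LocallyLipschitzOn s fun x => f x * g x :=
  locallyLipschitzOn_comp (t := univ) (g := fun p : ℝ × ℝ => p.1 * p.2)
    ((contDiff_fst.mul contDiff_snd).contDiffOn.locallyLipschitzOn_of_isOpen isOpen_univ)
    (locallyLipschitzOn_prodMk hf hg) (mapsTo_univ _ _)

/-- Compactness gives a Lipschitz constant on a ball one unit larger than a ball containing the
support. A pair with one point in the smaller ball and the other outside the larger is at distance
at least 1, so there the sup bound `M` serves as Lipschitz constant. -/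
theorem exists_lipschitzWith_of_tsupport_subset {E : Type*} [NormedAddCommGroup E]
    [NormedSpace ℝ E] [ProperSpace E] {f : E → ℝ} {U : Set E} (hU : IsOpen U)
    (hf : LocallyLipschitzOn U f) (hc : HasCompactSupport f) (hs : tsupport f ⊆ U) :
    ∃ C, LipschitzWith C f := by
  have hloc : LocallyLipschitz f := by
    intro x
    by_cases hx : x ∈ U
    · obtain ⟨K, t, ht, h⟩ := hf hx
      exact ⟨K, t, by rwa [hU.nhdsWithin_eq hx] at ht, h⟩
    · have hx' : x ∈ (tsupport f)ᶜ := fun h => hx (hs h)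
      refine ⟨0, (tsupport f)ᶜ, (isClosed_tsupport f).isOpen_compl.mem_nhds hx', ?_⟩
      intro y hy z hz
      simp [image_eq_zero_of_notMem_tsupport hy, image_eq_zero_of_notMem_tsupport hz]
  obtain ⟨R, hR⟩ := hc.isBounded.subset_closedBall 0
  obtain ⟨M, hM⟩ := (hloc.continuous.bounded_above_of_compact_support hc)
  obtain ⟨C, hC⟩ := (locallyLipschitzOn_univ.2 hloc).mono (subset_univ _)
    |>.exists_lipschitzOnWith_of_compact (isCompact_closedBall (0 : E) (R + 1))
  have hM0 : 0 ≤ M := (norm_nonneg _).trans (hM 0)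
  have key : ∀ x y, x ∈ closedBall (0 : E) R → dist (f x) (f y) ≤ max (C : ℝ) M * dist x y := by
    intro x y hx
    by_cases hy : y ∈ closedBall (0 : E) (R + 1)
    · refine (hC.dist_le_mul x (closedBall_subset_closedBall (by linarith) hx) y hy).trans ?_
      gcongr
      exact le_max_left _ _
    · have hfy : f y = 0 := image_eq_zero_of_notMem_tsupport
        fun h => hy (closedBall_subset_closedBall (by linarith) (hR h))
      have h1 : 1 ≤ dist x y := by
        rw [mem_closedBall, not_le] at hy
        have := dist_triangle_left y 0 x
        rw [mem_closedBall] at hx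
        linarith
      rw [hfy, dist_zero_right]
      calc ‖f x‖ ≤ M * 1 := by simpa using hM x
        _ ≤ max (C : ℝ) M * dist x y := by gcongr; exact le_max_right _ _
  refine ⟨⟨max (C : ℝ) M, le_max_of_le_right hM0⟩, LipschitzWith.of_dist_le_mul fun x y => ?_⟩
  change dist (f x) (f y) ≤ max (C : ℝ) M * dist x y
  by_cases hx : x ∈ closedBall (0 : E) R
  · exact key x y hx
  by_cases hy : y ∈ closedBall (0 : E) R
  · rw [dist_comm, dist_comm x]; exact key y x hy
  · rw [image_eq_zero_of_notMem_tsupport fun h => hx (hR h),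
      image_eq_zero_of_notMem_tsupport fun h => hy (hR h), dist_self]
    positivity

end Lipschitz

/-! ### Smooth cutoff functions and integration by parts -/

section IBP

/-- The value 1 is needed on a neighborhood of `K`, not just on `K`, so that multiplying by `η`
changes no derivative at points of `K`. -/
theorem exists_smooth_cutoff {E : Type*} [NormedAddCommGroup E]
    [NormedSpace ℝ E] [FiniteDimensional ℝ E] {K U : Set E}
    (hK : IsCompact K) (hU : IsOpen U) (hKU : K ⊆ U) :
    ∃ η : E → ℝ, ContDiff ℝ ∞ η ∧ HasCompactSupport η ∧ tsupport η ⊆ U ∧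
      (∀ᶠ x in 𝓝ˢ K, η x = 1) ∧ ∀ x, η x ∈ Icc (0 : ℝ) 1 := by
  obtain ⟨K₁, hK₁, hKK₁, hK₁U⟩ := exists_compact_between hK hU hKU
  obtain ⟨f, hf1, hf0, hf⟩ := exists_contMDiffMap_one_nhds_of_subset_interior
    (n := ⊤) (modelWithCornersSelf ℝ E) hK.isClosed hKK₁
  have hts : tsupport f ⊆ K₁ := closure_minimal
    (fun x hx => by_contra fun h => hx (hf0 x h)) hK₁.isClosed
  exact ⟨f, f.contMDiff.contDiff, hK₁.of_isClosed_subset (isClosed_tsupport _) hts,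
    hts.trans hK₁U, hf1, hf⟩

/-- A locally Lipschitz function agrees near a compact set with a globally Lipschitz one. -/
theorem exists_lipschitzWith_eq_near {E : Type*} [NormedAddCommGroup E]
    [NormedSpace ℝ E] [FiniteDimensional ℝ E] {f : E → ℝ} {K U : Set E} (hK : IsCompact K)
    (hU : IsOpen U) (hKU : K ⊆ U) (hf : LocallyLipschitzOn U f) :
    ∃ (F : E → ℝ) (C : NNReal), LipschitzWith C F ∧ ∀ᶠ x in 𝓝ˢ K, F x = f x := by
  obtain ⟨η, hη, hηc, hηU, hη1, -⟩ := exists_smooth_cutoff hK hU hKU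
  have : ProperSpace E := FiniteDimensional.proper ℝ E
  have hle : tsupport (fun x => η x * f x) ⊆ tsupport η := tsupport_mul_subset_left
  obtain ⟨C, hC⟩ := exists_lipschitzWith_of_tsupport_subset hU
    (f := fun x => η x * f x)
    (locallyLipschitzOn_mul ((hη.of_le (by simp)).contDiffOn.locallyLipschitzOn_of_isOpen hU) hf)
    (hηc.mul_right) (hle.trans hηU)
  exact ⟨_, C, hC, hη1.mono fun x hx => by simp [hx]⟩

theorem ae_differentiableAt_of_locallyLipschitzOn {f : 𝔼 → ℝ}
    {K U : Set 𝔼} (hK : IsCompact K)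
    (hU : IsOpen U) (hKU : K ⊆ U) (hf : LocallyLipschitzOn U f) :
    ∀ᵐ x, x ∈ K → DifferentiableAt ℝ f x := by
  obtain ⟨F, C, hF, hFf⟩ := exists_lipschitzWith_eq_near hK hU hKU hf
  filter_upwards [hF.ae_differentiableAt] with x hx hxK
  have : F =ᶠ[𝓝 x] f := hFf.filter_mono (nhds_le_nhdsSet hxK)
  exact this.differentiableAt_iff.1 hx

/-- Integration by parts for locally Lipschitz functions. -/
theorem integral_mul_fderiv_eq_neg {f ψ : 𝔼 → ℝ} {U : Set 𝔼}
    (hU : IsOpen U) (hf : LocallyLipschitzOn U f) (hψ : LocallyLipschitzOn U ψ)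
    (hψc : HasCompactSupport ψ) (hψU : tsupport ψ ⊆ U) (e : 𝔼) :
    ∫ x, f x * fderiv ℝ ψ x e = -∫ x, ψ x * fderiv ℝ f x e := by
  -- Both factors become globally Lipschitz, so Rademacher's theorem identifies line derivatives
  -- with `fderiv` almost everywhere; `F` differs from `f` only where `ψ` vanishes.
  obtain ⟨F, C, hF, hFf⟩ := exists_lipschitzWith_eq_near hψc hU hψU hf
  obtain ⟨D, hD⟩ := exists_lipschitzWith_of_tsupport_subset hU hψ hψc hψU
  have h := hF.integral_lineDeriv_mul_eq (μ := volume) hD hψc e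
  have h1 : ∫ x, lineDeriv ℝ F x e * ψ x = ∫ x, ψ x * fderiv ℝ f x e := by
    apply integral_congr_ae
    filter_upwards [hF.ae_differentiableAt] with x hx
    by_cases hxs : x ∈ tsupport ψ
    · have : F =ᶠ[𝓝 x] f := hFf.filter_mono (nhds_le_nhdsSet hxs)
      rw [hx.lineDeriv_eq_fderiv, this.fderiv_eq, mul_comm]
    · simp [image_eq_zero_of_notMem_tsupport hxs]
  have h2 : ∫ x, lineDeriv ℝ ψ x (-e) * F x = -∫ x, f x * fderiv ℝ ψ x e := by
    rw [← integral_neg]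
    apply integral_congr_ae
    filter_upwards [hD.ae_differentiableAt] with x hx
    rw [hx.lineDeriv_eq_fderiv]
    by_cases hxs : x ∈ tsupport ψ
    · rw [hFf.self_of_nhdsSet x hxs, map_neg]; ring
    · have : fderiv ℝ ψ x = 0 := by
        by_contra hne
        exact hxs (support_fderiv_subset ℝ hne)
      simp [this]
  rw [h1, h2] at h
  linarith

end IBP

/-! ### Mollification -/

section Mollification

open ContinuousLinearMap (lsmul)
open scoped Convolution

/-- The kernel is nonnegative with integral 1, so `|φ ⋆ k| ≤ φ ⋆ |k|` pointwise and the right side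
has the same integral as `|k|`. -/
theorem integral_norm_normed_convolution_le (φ : ContDiffBump (0 : 𝔼)) {k : 𝔼 → ℝ}
    (hk : Integrable k) :
    ∫ x, ‖(φ.normed volume ⋆[lsmul ℝ ℝ, volume] k) x‖ ≤ ∫ x, ‖k x‖ := by
  have hφ : Integrable (φ.normed volume) := φ.integrable_normed
  have h1 : ∫ x, (φ.normed volume ⋆[lsmul ℝ ℝ, volume] fun y => ‖k y‖) x = ∫ x, ‖k x‖ := by
    rw [integral_convolution _ hφ hk.norm, φ.integral_normed]
    simp
  rw [← h1]
  refine integral_mono (hφ.integrable_convolution _ hk).norm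
    (hφ.integrable_convolution _ hk.norm) fun x => ?_
  refine (norm_integral_le_integral_norm _).trans (le_of_eq ?_)
  simp only [convolution]
  congr 1
  ext t
  simp [abs_of_nonneg (φ.nonneg_normed t)]

/-- Once the kernel radius is below 1, the difference lives on the 1-thickening of the support and
is bounded by `2M` there, so dominated convergence applies. -/
theorem tendsto_integral_norm_convolution_sub_of_continuous {φ : ℕ → ContDiffBump (0 : 𝔼)}
    (hφ : Tendsto (fun n => (φ n).rOut) atTop (𝓝 0)) {f : 𝔼 → ℝ} (hf : Continuous f)
    (hfc : HasCompactSupport f) :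
    Tendsto (fun n => ∫ x, ‖((φ n).normed volume ⋆[lsmul ℝ ℝ, volume] f) x - f x‖) atTop
      (𝓝 0) := by
  obtain ⟨M, hM⟩ := hf.bounded_above_of_compact_support hfc
  have hM0 : 0 ≤ M := (norm_nonneg _).trans (hM 0)
  have hK : IsCompact (cthickening 1 (tsupport f)) := IsCompact.cthickening hfc
  have := tendsto_integral_filter_of_dominated_convergence (μ := volume) (l := atTop)
    (F := fun n x => ‖((φ n).normed volume ⋆[lsmul ℝ ℝ, volume] f) x - f x‖) (f := fun _ => 0)
    ((cthickening 1 (tsupport f)).indicator fun _ => 2 * M) ?_ ?_ ?_ ?_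
  · simpa using this
  · refine Eventually.of_forall fun n => ?_
    have := ((φ n).integrable_normed (μ := volume)).integrable_convolution (lsmul ℝ ℝ)
      (hf.integrable_of_hasCompactSupport hfc (μ := volume))
    exact (this.aestronglyMeasurable.sub hf.aestronglyMeasurable).norm
  · filter_upwards [hφ.eventually (Iio_mem_nhds one_pos)] with n hn
    refine Eventually.of_forall fun x => ?_
    rw [norm_norm, ← dist_eq_norm]
    apply ContDiffBump.dist_normed_convolution_le hf.aestronglyMeasurable
    intro y hy
    by_cases hx : x ∈ cthickening 1 (tsupport f)
    · rw [indicator_of_mem hx, dist_eq_norm]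
      exact (norm_sub_le _ _).trans (by linarith [hM x, hM y])
    · rw [indicator_of_notMem hx]
      have hz : ∀ z, dist z x ≤ 1 → f z = 0 := fun z hz =>
        image_eq_zero_of_notMem_tsupport fun h =>
          hx (mem_cthickening_of_dist_le x z 1 _ h (by rwa [dist_comm]))
      rw [hz y ((mem_ball.1 hy).le.trans (le_of_lt hn)), hz x (by simp), dist_self]
  · exact (integrable_indicator_iff hK.measurableSet).2 (integrableOn_const hK.measure_lt_top.ne)
  · refine Eventually.of_forall fun x => ?_
    have := ContDiffBump.convolution_tendsto_right_of_continuous (μ := volume) hφ hf x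
    simpa using (this.sub_const (f x)).norm

/-- Mollifications of an integrable function converge to it in `L¹`. -/
theorem tendsto_integral_norm_convolution_sub {φ : ℕ → ContDiffBump (0 : 𝔼)}
    (hφ : Tendsto (fun n => (φ n).rOut) atTop (𝓝 0)) {f : 𝔼 → ℝ} (hf : Integrable f) :
    Tendsto (fun n => ∫ x, ‖((φ n).normed volume ⋆[lsmul ℝ ℝ, volume] f) x - f x‖) atTop
      (𝓝 0) := by
  rw [Metric.tendsto_atTop]
  intro ε hε
  -- Density of compactly supported continuous functions: the errors `φ ⋆ (f - k)`, `φ ⋆ k - k` and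
  -- `f - k` cost at most `ε / 4` each.
  obtain ⟨k, hkc, hfk, hk, hki⟩ :=
    hf.exists_hasCompactSupport_integral_sub_le (ε := ε / 4) (by positivity)
  obtain ⟨n₀, hn₀⟩ := Metric.tendsto_atTop.1
    (tendsto_integral_norm_convolution_sub_of_continuous hφ hk hkc) (ε / 4) (by positivity)
  refine ⟨n₀, fun n hn => ?_⟩
  have h0 := hn₀ n hn
  rw [dist_zero_right, Real.norm_of_nonneg (integral_nonneg fun _ => norm_nonneg _)] at h0 ⊢
  have hφi : Integrable ((φ n).normed volume) := (φ n).integrable_normed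
  have hfki : Integrable (fun x => f x - k x) := hf.sub hki
  have h1 := integral_norm_normed_convolution_le (φ n) hfki
  have hc1 := hφi.integrable_convolution (lsmul ℝ ℝ) hfki
  have hc2 := hφi.integrable_convolution (lsmul ℝ ℝ) hki
  have hex : ∀ {g : 𝔼 → ℝ}, Integrable g → ∀ x,
      ConvolutionExistsAt ((φ n).normed volume) g x (lsmul ℝ ℝ) volume := fun hg x =>
    HasCompactSupport.convolutionExists_left _ (φ n).hasCompactSupport_normed
      (φ n).continuous_normed hg.locallyIntegrable x
  have hsplit : ∀ x, ((φ n).normed volume ⋆[lsmul ℝ ℝ, volume] f) x - f x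
      = ((φ n).normed volume ⋆[lsmul ℝ ℝ, volume] fun x => f x - k x) x
        + (((φ n).normed volume ⋆[lsmul ℝ ℝ, volume] k) x - k x) - (f x - k x) := by
    intro x
    have h := (hex hfki x).distrib_add (hex hki x)
    have hfe : (fun x => f x - k x) + k = f := by ext; simp
    rw [hfe] at h
    rw [h]; ring
  calc ∫ x, ‖((φ n).normed volume ⋆[lsmul ℝ ℝ, volume] f) x - f x‖
      ≤ ∫ x, (‖((φ n).normed volume ⋆[lsmul ℝ ℝ, volume] fun x => f x - k x) x‖
        + ‖((φ n).normed volume ⋆[lsmul ℝ ℝ, volume] k) x - k x‖ + ‖f x - k x‖) := by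
        refine integral_mono ((hφi.integrable_convolution _ hf).sub hf).norm
          ((hc1.norm.add (hc2.sub hki).norm).add hfki.norm) fun x => ?_
        rw [hsplit]
        exact (norm_sub_le _ _).trans (add_le_add_left (norm_add_le _ _) _)
    _ = (∫ x, ‖((φ n).normed volume ⋆[lsmul ℝ ℝ, volume] fun x => f x - k x) x‖)
        + (∫ x, ‖((φ n).normed volume ⋆[lsmul ℝ ℝ, volume] k) x - k x‖)
        + ∫ x, ‖f x - k x‖ := by
        exact (integral_add (hc1.norm.add (hc2.sub hki).norm) hfki.norm).trans
          (congrArg (· + _) (integral_add hc1.norm (hc2.sub hki).norm))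
    _ < ε := by linarith

/-- The derivative of a mollification is the mollification of the weak gradient. -/
theorem fderiv_convolution_of_hasWeakGradientOn {u : 𝔼 → ℝ} {g : 𝔼 → 𝔼} {U K' : Set 𝔼}
    (hug : HasWeakGradientOn u g U) (hU : MeasurableSet U) (hK' : IsCompact K') (hKU : K' ⊆ U)
    (φ : ContDiffBump (0 : 𝔼)) {x : 𝔼} (hx : closedBall x φ.rOut ⊆ K') (e : 𝔼) :
    fderiv ℝ (φ.normed volume ⋆[lsmul ℝ ℝ, volume] K'.indicator u) x e
      = (φ.normed volume ⋆[lsmul ℝ ℝ, volume] K'.indicator fun y => inner ℝ (g y) e) x := by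
  have hφc : ContDiff ℝ ∞ (φ.normed volume) := φ.contDiff_normed
  have hui : Integrable (K'.indicator u) := (integrable_indicator_iff hK'.measurableSet).2
    (hug.locallyIntegrable.integrableOn_compact_subset hKU hK')
  have hder := φ.hasCompactSupport_normed.hasFDerivAt_convolution_left (lsmul ℝ ℝ)
    (hφc.of_le (by simp)) hui.locallyIntegrable (μ := volume) x
  have hexist : ConvolutionExistsAt (fderiv ℝ (φ.normed volume)) (K'.indicator u) x
      ((lsmul ℝ ℝ).precompL 𝔼) volume :=
    HasCompactSupport.convolutionExists_left _ (φ.hasCompactSupport_normed.fderiv ℝ)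
      (hφc.continuous_fderiv (by simp)) hui.locallyIntegrable x
  rw [hder.fderiv]
  set ψ : 𝔼 → ℝ := fun y => φ.normed volume (x - y) with hψ
  have hψd : ∀ y, fderiv ℝ ψ y e = -fderiv ℝ (φ.normed volume) (x - y) e := by
    intro y
    have h1 : HasFDerivAt (fun y => x - y) (-ContinuousLinearMap.id ℝ 𝔼) y :=
      (hasFDerivAt_id y).const_sub x
    have h2 := ((hφc.differentiable (by simp)) (x - y)).hasFDerivAt.comp y h1
    rw [show ψ = φ.normed volume ∘ fun y => x - y from rfl, h2.fderiv]
    simp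
  have hψs : tsupport ψ ⊆ closedBall x φ.rOut := by
    refine closure_minimal (fun y hy => ?_) isClosed_closedBall
    have : x - y ∈ Function.support (φ.normed volume) := hy
    rw [φ.support_normed_eq, mem_ball_zero_iff] at this
    rw [mem_closedBall, dist_comm, dist_eq_norm]
    exact this.le
  have hψc : HasCompactSupport ψ :=
    (isCompact_closedBall x φ.rOut).of_isClosed_subset (isClosed_tsupport _) hψs
  have hweak := hug.integral_eq ψ (hφc.comp (contDiff_const.sub contDiff_id)) hψc
    (hψs.trans (hx.trans hKU)) e
  -- Both integrands are supported in the kernel's ball around `x`, which lies in `K'`; this trades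
  -- `U` for the compact set on which `u` was cut off.
  have hind : ∀ F : 𝔼 → ℝ, (∀ y ∉ closedBall x φ.rOut, F y = 0) →
      ∫ y in U, F y = ∫ y, K'.indicator F y := by
    intro F hF
    rw [← integral_indicator hU]
    congr 1
    ext y
    by_cases hy : y ∈ closedBall x φ.rOut
    · rw [indicator_of_mem (hx hy), indicator_of_mem (hKU (hx hy))]
    · simp [indicator, hF y hy]
  rw [hind _ fun y hy => by
      have : y ∉ tsupport (fderiv ℝ ψ) := fun h => hy (hψs (tsupport_fderiv_subset ℝ h))
      simp [image_eq_zero_of_notMem_tsupport this],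
    hind _ fun y hy => by simp [image_eq_zero_of_notMem_tsupport fun h => hy (hψs h)]] at hweak
  have hl : (fderiv ℝ (φ.normed volume) ⋆[(lsmul ℝ ℝ).precompL 𝔼, volume] K'.indicator u) x e
      = -∫ y, K'.indicator (fun y => u y * fderiv ℝ ψ y e) y := by
    rw [convolution_def, ContinuousLinearMap.integral_apply hexist,
      ← integral_sub_left_eq_self _ volume x, ← integral_neg]
    congr 1
    ext y
    simp only [ContinuousLinearMap.precompL_apply, sub_sub_cancel, hψd]
    by_cases hy : y ∈ K' <;> simp [hy, mul_comm]
  rw [hl, hweak, neg_neg, convolution_def, ← integral_sub_left_eq_self _ volume x]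
  congr 1
  ext y
  by_cases hy : x - y ∈ K' <;> simp [hy, hψ]

/-- A sequence of bump functions shrinking to the origin. -/
theorem exists_contDiffBump_seq {δ : ℝ} (hδ : 0 < δ) :
    ∃ φ : ℕ → ContDiffBump (0 : 𝔼), Tendsto (fun n => (φ n).rOut) atTop (𝓝 0) ∧
      ∀ n, (φ n).rOut ≤ δ := by
  refine ⟨fun n => ⟨δ / (n + 1) / 2, δ / (n + 1), by positivity, half_lt_self (by positivity)⟩,
    ?_, fun n => ?_⟩
  · exact tendsto_const_div_atTop_nhds_zero_nat δ |>.comp (tendsto_add_atTop_nat 1)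
      |>.congr fun n => by simp
  · exact div_le_self hδ.le (by simp)

theorem tendstoUniformlyOn_convolution {φ : ℕ → ContDiffBump (0 : 𝔼)} {δ : ℝ}
    (hφ : Tendsto (fun n => (φ n).rOut) atTop (𝓝 0)) (hδ : ∀ n, (φ n).rOut ≤ δ)
    {u : 𝔼 → ℝ} {K K' : Set 𝔼} (hK' : IsCompact K') (hK : ∀ x ∈ K, closedBall x δ ⊆ K')
    (hu : ContinuousOn u K') :
    TendstoUniformlyOn
      (fun n => (φ n).normed volume ⋆[lsmul ℝ ℝ, volume] K'.indicator u) u atTop K := by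
  have huc := hK'.uniformContinuousOn_of_continuous hu
  rw [Metric.uniformContinuousOn_iff] at huc
  rw [Metric.tendstoUniformlyOn_iff]
  intro ε hε
  obtain ⟨κ, hκ, h⟩ := huc (ε / 2) (half_pos hε)
  filter_upwards [hφ.eventually (Iio_mem_nhds hκ)] with n hn x hx
  have hxK' : x ∈ K' := hK x hx (mem_closedBall_self ((φ n).rOut_pos.le.trans (hδ n)))
  have hm : AEStronglyMeasurable (K'.indicator u) volume :=
    (aestronglyMeasurable_indicator_iff hK'.measurableSet).2
      (hu.aestronglyMeasurable hK'.measurableSet)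
  have := (φ n).dist_normed_convolution_le (x₀ := x) (ε := ε / 2) hm fun y hy => by
    have hyK' : y ∈ K' := hK x hx (closedBall_subset_closedBall (hδ n) (ball_subset_closedBall hy))
    rw [indicator_of_mem hyK', indicator_of_mem hxK']
    exact (h y hyK' x hxK' ((mem_ball.1 hy).trans hn)).le
  rw [indicator_of_mem hxK', dist_comm] at this
  linarith

end Mollification

/-! ### Calculus of weak gradients -/

section WeakGradient

open ContinuousLinearMap (lsmul)
open scoped Convolution

/-- Continuous functions with a weak gradient are locally limits of smooth functions. -/
theorem HasWeakGradientOn.exists_smooth_approx {u : 𝔼 → ℝ} {g : 𝔼 → 𝔼} {U K : Set 𝔼}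
    (hug : HasWeakGradientOn u g U) (hU : IsOpen U) (hu : ContinuousOn u U) (hK : IsCompact K)
    (hKU : K ⊆ U) :
    ∃ un : ℕ → 𝔼 → ℝ, (∀ n, ContDiff ℝ ∞ (un n)) ∧ TendstoUniformlyOn un u atTop K ∧
      (∀ e, Tendsto (fun n => ∫ x in K, ‖fderiv ℝ (un n) x e - inner ℝ (g x) e‖) atTop (𝓝 0)) ∧
      ((∀ᵐ x ∂volume.restrict U, g x = 0) → ∀ n, ∀ x ∈ K, fderiv ℝ (un n) x = 0) := by
  obtain ⟨δ, hδ, hδU⟩ := hK.exists_cthickening_subset_open hU hKU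
  obtain ⟨φ, hφ, hφδ⟩ := exists_contDiffBump_seq (d := d) hδ
  -- Cutting `u` off outside `K'` makes it integrable on the whole space without affecting its
  -- mollifications on `K`, since every kernel radius is at most `δ`.
  set K' := cthickening δ K with hK'def
  have hK' : IsCompact K' := hK.cthickening
  have hball : ∀ x ∈ K, closedBall x δ ⊆ K' := fun x hx => closedBall_subset_cthickening hx δ
  have hball' : ∀ n, ∀ x ∈ K, closedBall x (φ n).rOut ⊆ K' := fun n x hx =>
    (closedBall_subset_closedBall (hφδ n)).trans (hball x hx)
  have hui : Integrable (K'.indicator u) := (integrable_indicator_iff hK'.measurableSet).2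
    (hug.locallyIntegrable.integrableOn_compact_subset hδU hK')
  have hgi : ∀ e, Integrable (K'.indicator fun y => inner ℝ (g y) e) := fun e =>
    (integrable_indicator_iff hK'.measurableSet).2
      ((hug.locallyIntegrable_grad.integrableOn_compact_subset hδU hK').inner_const e)
  have hder := fun n x hx e => fderiv_convolution_of_hasWeakGradientOn hug hU.measurableSet hK'
    hδU (φ n) (hball' n x hx) e
  refine ⟨fun n => (φ n).normed volume ⋆[lsmul ℝ ℝ, volume] K'.indicator u, fun n => ?_,
    tendstoUniformlyOn_convolution hφ hφδ hK' hball (hu.mono hδU), fun e => ?_,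
    fun hg n x hx => ?_⟩
  · exact (φ n).hasCompactSupport_normed.contDiff_convolution_left _ (n := ⊤)
      (φ n).contDiff_normed hui.locallyIntegrable
  · refine squeeze_zero (fun n => integral_nonneg fun _ => norm_nonneg _) (fun n => ?_)
      (tendsto_integral_norm_convolution_sub hφ (hgi e))
    have hInt := ((((φ n).integrable_normed (μ := volume)).integrable_convolution (lsmul ℝ ℝ)
      (hgi e)).sub (hgi e)).norm
    refine (le_of_eq (setIntegral_congr_fun hK.measurableSet fun x hx => ?_)).trans
      (setIntegral_le_integral hInt (Eventually.of_forall fun _ => norm_nonneg _))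
    have hxK' : x ∈ K' := hball x hx (mem_closedBall_self hδ.le)
    simp only
    rw [hder n x hx e, indicator_of_mem hxK']
  -- A vanishing weak gradient gives exactly vanishing derivatives of the approximants, not only in
  -- the limit; this makes them constant on balls.
  · ext e
    have hg0 : (K'.indicator fun y => inner ℝ (g y) e) =ᵐ[volume] fun _ => (0 : ℝ) := by
      filter_upwards [(ae_restrict_iff' hU.measurableSet).1 hg] with y hy
      by_cases hyK : y ∈ K'
      · simp [hyK, hy (hδU hyK)]
      · simp [hyK]
    rw [hder n x hx e, convolution_congr _ EventuallyEq.rfl hg0]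
    simp [convolution_def]

/-- Split `a n * D n = a n * D' + a n * (D n - D')`: dominated convergence handles the first term,
the uniform bound times the `L¹` distance the second. Here `D n` will be a derivative of an
approximant. -/
theorem tendsto_integral_mul_of_tendsto_L1 {X : Type*} [MeasurableSpace X] {μ : Measure X}
    {a D : ℕ → X → ℝ} {a' D' : X → ℝ} {M : ℝ} (ha : ∀ n, AEStronglyMeasurable (a n) μ)
    (hM : ∀ᶠ n in atTop, ∀ᵐ x ∂μ, ‖a n x‖ ≤ M)
    (hlim : ∀ᵐ x ∂μ, Tendsto (fun n => a n x) atTop (𝓝 (a' x)))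
    (hD : ∀ n, Integrable (D n) μ) (hD' : Integrable D' μ)
    (hDD : Tendsto (fun n => ∫ x, ‖D n x - D' x‖ ∂μ) atTop (𝓝 0)) :
    Tendsto (fun n => ∫ x, a n x * D n x ∂μ) atTop (𝓝 (∫ x, a' x * D' x ∂μ)) := by
  have h1 : Tendsto (fun n => ∫ x, a n x * D' x ∂μ) atTop (𝓝 (∫ x, a' x * D' x ∂μ)) := by
    refine tendsto_integral_filter_of_dominated_convergence (fun x => M * ‖D' x‖)
      (Eventually.of_forall fun n => (ha n).mul hD'.aestronglyMeasurable) ?_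
      (hD'.norm.const_mul M) (hlim.mono fun x hx => hx.mul_const _)
    filter_upwards [hM] with n hn
    filter_upwards [hn] with x hx
    rw [norm_mul]
    gcongr
  have h2 : Tendsto (fun n => ∫ x, a n x * (D n x - D' x) ∂μ) atTop (𝓝 0) := by
    have hb : ∀ᶠ n in atTop, ‖∫ x, a n x * (D n x - D' x) ∂μ‖ ≤ M * ∫ x, ‖D n x - D' x‖ ∂μ := by
      filter_upwards [hM] with n hn
      rw [← integral_const_mul]
      refine norm_integral_le_of_norm_le (((hD n).sub hD').norm.const_mul M) ?_
      filter_upwards [hn] with x hx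
      rw [norm_mul]
      gcongr
    exact squeeze_zero_norm' hb (by simpa using hDD.const_mul M)
  have h3 := h1.add h2
  rw [add_zero] at h3
  refine h3.congr' ?_
  filter_upwards [hM] with n hn
  have hi : Integrable (fun x => a n x * (D n x - D' x)) μ := ((hD n).sub hD').bdd_mul (ha n) hn
  rw [← integral_add (hD'.bdd_mul (ha n) hn) hi]
  congr 1
  ext x
  ring

theorem setIntegral_eq_setIntegral_of_zero_off {F : 𝔼 → ℝ} {K U : Set 𝔼}
    (hU : MeasurableSet U) (hKU : K ⊆ U) (hF : ∀ x ∉ K, F x = 0) :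
    ∫ x in U, F x = ∫ x in K, F x :=
  (setIntegral_eq_of_subset_of_forall_sdiff_eq_zero hU hKU fun x hx => hF x hx.2)

/-- If `un → u` uniformly on a compact set on which `u` is continuous, the `un` are eventually
uniformly bounded there. -/
theorem exists_eventually_bound_of_tendstoUniformlyOn {un : ℕ → 𝔼 → ℝ} {u : 𝔼 → ℝ} {K : Set 𝔼}
    (hK : IsCompact K) (hu : ContinuousOn u K) (h : TendstoUniformlyOn un u atTop K) :
    ∃ M, (∀ᶠ n in atTop, ∀ x ∈ K, ‖un n x‖ ≤ M) ∧ ∀ x ∈ K, ‖u x‖ ≤ M := by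
  obtain ⟨M, hM⟩ := hK.exists_bound_of_continuousOn hu
  refine ⟨M + 1, ?_, fun x hx => (hM x hx).trans (by linarith)⟩
  filter_upwards [Metric.tendstoUniformlyOn_iff.1 h 1 one_pos] with n hn x hx
  have := hn x hx
  rw [dist_comm, dist_eq_norm] at this
  have h2 := norm_le_norm_add_norm_sub' (un n x) (u x)
  linarith [hM x hx]

/-- The weak gradient may be tested against locally Lipschitz functions. -/
theorem HasWeakGradientOn.integral_eq_of_locallyLipschitz {u : 𝔼 → ℝ} {g : 𝔼 → 𝔼} {U : Set 𝔼}
    (hug : HasWeakGradientOn u g U) (hU : IsOpen U) (hu : ContinuousOn u U) {ψ : 𝔼 → ℝ}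
    (hψ : LocallyLipschitzOn U ψ) (hψc : HasCompactSupport ψ) (hψU : tsupport ψ ⊆ U) (e : 𝔼) :
    ∫ x in U, u x * fderiv ℝ ψ x e = -∫ x in U, ψ x * inner ℝ (g x) e := by
  obtain ⟨un, hun, hunu, hgrad, -⟩ := hug.exists_smooth_approx hU hu hψc hψU
  obtain ⟨D, hD⟩ := exists_lipschitzWith_of_tsupport_subset hU hψ hψc hψU
  have hK : IsCompact (tsupport ψ) := hψc
  obtain ⟨M, hM, -⟩ := exists_eventually_bound_of_tendstoUniformlyOn hK (hu.mono hψU) hunu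
  obtain ⟨P, hP⟩ := hD.continuous.bounded_above_of_compact_support hψc
  have hz1 : ∀ x ∉ tsupport ψ, fderiv ℝ ψ x e = 0 := fun x hx => by
    have : x ∉ tsupport (fderiv ℝ ψ) := fun h => hx (tsupport_fderiv_subset ℝ h)
    simp [image_eq_zero_of_notMem_tsupport this]
  have hz2 : ∀ x ∉ tsupport ψ, ψ x = 0 := fun x hx => image_eq_zero_of_notMem_tsupport hx
  have hψi : IntegrableOn (fun x => fderiv ℝ ψ x e) (tsupport ψ) := by
    refine Measure.integrableOn_of_bounded (M := D * ‖e‖) hK.measure_lt_top.ne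
      (measurable_fderiv_apply_const ℝ ψ e).aestronglyMeasurable ?_
    refine Eventually.of_forall fun x => ((fderiv ℝ ψ x).le_opNorm e).trans ?_
    gcongr
    exact norm_fderiv_le_of_lipschitz ℝ hD
  rw [setIntegral_eq_setIntegral_of_zero_off hU.measurableSet hψU
      fun x hx => by rw [hz1 x hx, mul_zero],
    setIntegral_eq_setIntegral_of_zero_off hU.measurableSet hψU
      fun x hx => by rw [hz2 x hx, zero_mul]]
  have hl : Tendsto (fun n => ∫ x in tsupport ψ, un n x * fderiv ℝ ψ x e) atTop
      (𝓝 (∫ x in tsupport ψ, u x * fderiv ℝ ψ x e)) :=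
    tendsto_integral_mul_of_tendsto_L1 (M := M)
      (fun n => (hun n).continuous.aestronglyMeasurable)
      (hM.mono fun n hn => ae_restrict_of_forall_mem hK.measurableSet hn)
      (ae_restrict_of_forall_mem hK.measurableSet fun x hx => hunu.tendsto_at hx)
      (fun _ => hψi) hψi (by simp)
  have hr : Tendsto (fun n => ∫ x in tsupport ψ, ψ x * fderiv ℝ (un n) x e) atTop
      (𝓝 (∫ x in tsupport ψ, ψ x * inner ℝ (g x) e)) :=
    tendsto_integral_mul_of_tendsto_L1 (M := P) (a := fun _ => ψ)
      (fun n => hD.continuous.aestronglyMeasurable)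
      (Eventually.of_forall fun n => Eventually.of_forall hP)
      (Eventually.of_forall fun x => tendsto_const_nhds)
      (fun n => ((((hun n).continuous_fderiv (by simp)).clm_apply
        continuous_const).continuousOn.integrableOn_compact hK))
      ((hug.locallyIntegrable_grad.integrableOn_compact_subset hψU hK).inner_const e) (hgrad e)
  refine tendsto_nhds_unique hl (hr.neg.congr fun n => ?_)
  have := integral_mul_fderiv_eq_neg hU
    (((hun n).of_le (by simp)).contDiffOn.locallyLipschitzOn_of_isOpen hU) hψ hψc hψU e
  rw [setIntegral_eq_integral_of_forall_compl_eq_zero fun x hx => by rw [hz2 x hx, zero_mul],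
    setIntegral_eq_integral_of_forall_compl_eq_zero fun x hx => by rw [hz1 x hx, mul_zero], this]

/-- Chain rule for weak gradients. -/
theorem HasWeakGradientOn.comp_contDiff {u : 𝔼 → ℝ} {g : 𝔼 → 𝔼} {U : Set 𝔼}
    (hug : HasWeakGradientOn u g U) (hU : IsOpen U) (hu : ContinuousOn u U) {G : ℝ → ℝ}
    (hG : ContDiff ℝ 1 G) :
    HasWeakGradientOn (fun x => G (u x)) (fun x => deriv G (u x) • g x) U := by
  have hG' : Continuous (deriv G) := hG.continuous_deriv le_rfl
  refine ⟨(hG.continuous.comp_continuousOn hu).locallyIntegrableOn hU.measurableSet,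
    hug.locallyIntegrable_grad.continuousOn_smul hU.isLocallyClosed (hG'.comp_continuousOn hu),
    fun ψ hψ hψc hψU e => ?_⟩
  obtain ⟨un, hun, hunu, hgrad, -⟩ := hug.exists_smooth_approx hU hu hψc hψU
  have hK : IsCompact (tsupport ψ) := hψc
  obtain ⟨M, hM, -⟩ := exists_eventually_bound_of_tendstoUniformlyOn hK (hu.mono hψU) hunu
  obtain ⟨P, hP⟩ := hψ.continuous.bounded_above_of_compact_support hψc
  -- Neither `G` nor `G'` needs a global bound: on the support of `ψ` the approximants eventually
  -- take values in `[-M, M]`.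
  obtain ⟨Q, hQ⟩ := (isCompact_closedBall (0 : ℝ) M).exists_bound_of_continuousOn
    hG.continuous.continuousOn
  obtain ⟨Q', hQ'⟩ := (isCompact_closedBall (0 : ℝ) M).exists_bound_of_continuousOn
    hG'.continuousOn
  have hψ' : Continuous fun x => fderiv ℝ ψ x e :=
    (hψ.continuous_fderiv (by simp)).clm_apply continuous_const
  have hz1 : ∀ x ∉ tsupport ψ, fderiv ℝ ψ x e = 0 := fun x hx => by
    have : x ∉ tsupport (fderiv ℝ ψ) := fun h => hx (tsupport_fderiv_subset ℝ h)
    simp [image_eq_zero_of_notMem_tsupport this]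
  have hz2 : ∀ x ∉ tsupport ψ, ψ x = 0 := fun x hx => image_eq_zero_of_notMem_tsupport hx
  rw [setIntegral_eq_setIntegral_of_zero_off hU.measurableSet hψU
      fun x hx => by rw [hz1 x hx, mul_zero],
    setIntegral_eq_setIntegral_of_zero_off hU.measurableSet hψU
      fun x hx => by rw [hz2 x hx, zero_mul]]
  have hψi : IntegrableOn (fun x => fderiv ℝ ψ x e) (tsupport ψ) :=
    hψ'.continuousOn.integrableOn_compact hK
  have hl : Tendsto (fun n => ∫ x in tsupport ψ, G (un n x) * fderiv ℝ ψ x e) atTop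
      (𝓝 (∫ x in tsupport ψ, G (u x) * fderiv ℝ ψ x e)) :=
    tendsto_integral_mul_of_tendsto_L1 (M := Q)
      (fun n => (hG.continuous.comp (hun n).continuous).aestronglyMeasurable)
      (hM.mono fun n hn => ae_restrict_of_forall_mem hK.measurableSet fun x hx =>
        hQ _ (by simpa using hn x hx))
      (ae_restrict_of_forall_mem hK.measurableSet fun x hx =>
        (hG.continuous.tendsto _).comp (hunu.tendsto_at hx))
      (fun _ => hψi) hψi (by simp)
  have hr : Tendsto (fun n => ∫ x in tsupport ψ, (ψ x * deriv G (un n x)) * fderiv ℝ (un n) x e)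
      atTop (𝓝 (∫ x in tsupport ψ, (ψ x * deriv G (u x)) * inner ℝ (g x) e)) :=
    tendsto_integral_mul_of_tendsto_L1 (M := P * Q')
      (fun n => (hψ.continuous.mul (hG'.comp (hun n).continuous)).aestronglyMeasurable)
      (hM.mono fun n hn => ae_restrict_of_forall_mem hK.measurableSet fun x hx => by
        rw [norm_mul]
        exact mul_le_mul (hP x) (hQ' _ (by simpa using hn x hx)) (norm_nonneg _)
          ((norm_nonneg _).trans (hP x)))
      (ae_restrict_of_forall_mem hK.measurableSet fun x hx =>
        ((hG'.tendsto _).comp (hunu.tendsto_at hx)).const_mul _)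
      (fun n => ((((hun n).continuous_fderiv (by simp)).clm_apply
        continuous_const).continuousOn.integrableOn_compact hK))
      ((hug.locallyIntegrable_grad.integrableOn_compact_subset hψU hK).inner_const e) (hgrad e)
  have hr' : ∫ x in tsupport ψ, (ψ x * deriv G (u x)) * inner ℝ (g x) e
      = ∫ x in tsupport ψ, ψ x * inner ℝ (deriv G (u x) • g x) e := by
    congr 1
    ext x
    rw [real_inner_smul_left, mul_assoc]
  rw [hr'] at hr
  refine tendsto_nhds_unique hl (hr.neg.congr fun n => ?_)
  have hGu : ContDiff ℝ 1 (fun x => G (un n x)) := hG.comp ((hun n).of_le (by simp))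
  have := integral_mul_fderiv_eq_neg hU (hGu.contDiffOn.locallyLipschitzOn_of_isOpen hU)
    ((hψ.of_le (by simp)).contDiffOn.locallyLipschitzOn_of_isOpen hU) hψc hψU e
  rw [setIntegral_eq_integral_of_forall_compl_eq_zero
      (f := fun x => G (un n x) * fderiv ℝ ψ x e) fun x hx => by rw [hz1 x hx, mul_zero],
    setIntegral_eq_integral_of_forall_compl_eq_zero fun x hx => by
      rw [hz2 x hx, zero_mul, zero_mul], this]
  congr 2
  ext x
  have h1 : HasFDerivAt (fun x => G (un n x)) (deriv G (un n x) • fderiv ℝ (un n) x) x :=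
    ((hG.differentiable one_ne_zero _).hasDerivAt).comp_hasFDerivAt x
      ((hun n).differentiable (by simp) x).hasFDerivAt
  rw [h1.fderiv]
  simp [mul_assoc]

/-- The gradient of a locally Lipschitz function is its weak gradient. -/
theorem hasWeakGradientOn_of_locallyLipschitzOn {f : 𝔼 → ℝ} {U : Set 𝔼} (hU : IsOpen U)
    (hf : LocallyLipschitzOn U f) : HasWeakGradientOn f (∇ f) U := by
  have hmeas : Measurable (∇ f) :=
    (InnerProductSpace.toDual ℝ 𝔼).symm.continuous.measurable.comp (measurable_fderiv ℝ f)
  refine ⟨hf.continuousOn.locallyIntegrableOn hU.measurableSet, ?_, fun ψ hψ hψc hψU e => ?_⟩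
  · rw [locallyIntegrableOn_iff hU.isLocallyClosed]
    intro K hKU hK
    obtain ⟨F, C, hF, hFf⟩ := exists_lipschitzWith_eq_near hK hU hKU hf
    refine Measure.integrableOn_of_bounded (M := C) hK.measure_lt_top.ne
      hmeas.aestronglyMeasurable (ae_restrict_of_forall_mem hK.measurableSet fun x hx => ?_)
    have : F =ᶠ[𝓝 x] f := hFf.filter_mono (nhds_le_nhdsSet hx)
    rw [gradient, LinearIsometryEquiv.norm_map, ← this.fderiv_eq]
    exact norm_fderiv_le_of_lipschitz ℝ hF
  · have := integral_mul_fderiv_eq_neg hU hf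
      ((hψ.of_le (by simp)).contDiffOn.locallyLipschitzOn_of_isOpen hU) hψc hψU e
    have hz1 : ∀ x ∉ U, fderiv ℝ ψ x e = 0 := fun x hx => by
      have : x ∉ tsupport (fderiv ℝ ψ) := fun h => hx (hψU (tsupport_fderiv_subset ℝ h))
      simp [image_eq_zero_of_notMem_tsupport this]
    have hz2 : ∀ x ∉ U, ψ x = 0 := fun x hx =>
      image_eq_zero_of_notMem_tsupport fun h => hx (hψU h)
    rw [setIntegral_eq_integral_of_forall_compl_eq_zero fun x hx => by rw [hz1 x hx, mul_zero],
      setIntegral_eq_integral_of_forall_compl_eq_zero fun x hx => by rw [hz2 x hx, zero_mul],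
      this]
    simp [gradient]

theorem HasWeakGradientOn.sub {u f : 𝔼 → ℝ} {g h : 𝔼 → 𝔼} {U : Set 𝔼} (hU : MeasurableSet U)
    (hf : HasWeakGradientOn f h U) (hu : HasWeakGradientOn u g U) :
    HasWeakGradientOn (fun x => f x - u x) (fun x => h x - g x) U := by
  refine ⟨hf.locallyIntegrable.sub hu.locallyIntegrable,
    hf.locallyIntegrable_grad.sub hu.locallyIntegrable_grad, fun ψ hψ hψc hψU e => ?_⟩
  have hK : IsCompact (tsupport ψ) := hψc
  have hψ' : Continuous fun x => fderiv ℝ ψ x e :=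
    (hψ.continuous_fderiv (by simp)).clm_apply continuous_const
  have hz1 : ∀ x ∉ tsupport ψ, fderiv ℝ ψ x e = 0 := fun x hx => by
    have : x ∉ tsupport (fderiv ℝ ψ) := fun h => hx (tsupport_fderiv_subset ℝ h)
    simp [image_eq_zero_of_notMem_tsupport this]
  have hz2 : ∀ x ∉ tsupport ψ, ψ x = 0 := fun x hx => image_eq_zero_of_notMem_tsupport hx
  have e1 := hf.integral_eq ψ hψ hψc hψU e
  have e2 := hu.integral_eq ψ hψ hψc hψU e
  have hr1 : ∀ F : 𝔼 → ℝ, ∫ x in U, F x * fderiv ℝ ψ x e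
      = ∫ x in tsupport ψ, F x * fderiv ℝ ψ x e := fun F =>
    setIntegral_eq_setIntegral_of_zero_off hU hψU fun x hx => by rw [hz1 x hx, mul_zero]
  have hr2 : ∀ F : 𝔼 → ℝ, ∫ x in U, ψ x * F x = ∫ x in tsupport ψ, ψ x * F x := fun F =>
    setIntegral_eq_setIntegral_of_zero_off hU hψU fun x hx => by rw [hz2 x hx, zero_mul]
  have hi1 : ∀ {F : 𝔼 → ℝ}, LocallyIntegrableOn F U →
      IntegrableOn (fun x => F x * fderiv ℝ ψ x e) (tsupport ψ) := fun hF =>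
    (hF.integrableOn_compact_subset hψU hK).mul_continuousOn hψ'.continuousOn hK
  have hi2 : ∀ {F : 𝔼 → 𝔼}, LocallyIntegrableOn F U →
      IntegrableOn (fun x => ψ x * inner ℝ (F x) e) (tsupport ψ) := fun {F} hF =>
    have h : IntegrableOn (fun x => inner ℝ (F x) e) (tsupport ψ) :=
      (hF.integrableOn_compact_subset hψU hK).inner_const e
    h.continuousOn_mul hψ.continuous.continuousOn hK
  rw [hr1] at e1 e2 ⊢
  rw [hr2] at e1 e2 ⊢
  simp only [sub_mul, inner_sub_left, mul_sub]
  rw [integral_sub (hi1 hf.locallyIntegrable) (hi1 hu.locallyIntegrable),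
    integral_sub (hi2 hf.locallyIntegrable_grad) (hi2 hu.locallyIntegrable_grad), e1, e2]
  ring

/-- A continuous function with vanishing weak gradient is locally constant. -/
theorem HasWeakGradientOn.eventually_eq_of_ae_zero {u : 𝔼 → ℝ} {g : 𝔼 → 𝔼} {U : Set 𝔼}
    (hug : HasWeakGradientOn u g U) (hU : IsOpen U) (hu : ContinuousOn u U)
    (hg : ∀ᵐ x ∂volume.restrict U, g x = 0) {x : 𝔼} (hx : x ∈ U) :
    ∀ᶠ y in 𝓝 x, u y = u x := by
  obtain ⟨δ, hδ, hδU⟩ := Metric.nhds_basis_closedBall.mem_iff.1 (hU.mem_nhds hx)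
  obtain ⟨un, hun, hunu, -, hzero⟩ := hug.exists_smooth_approx hU hu (isCompact_closedBall x δ) hδU
  filter_upwards [ball_mem_nhds x hδ] with y hy
  refine tendsto_nhds_unique (hunu.tendsto_at (ball_subset_closedBall hy))
    ((hunu.tendsto_at (mem_closedBall_self hδ.le)).congr fun n => ?_)
  refine (isOpen_ball (x := x) (ε := δ)).is_const_of_fderiv_eq_zero (𝕜 := ℝ)
    (convex_ball x δ).isPreconnected ((hun n).differentiable (by simp)).differentiableOn
    (fun z hz => hzero hg n z (ball_subset_closedBall hz)) (mem_ball_self hδ) hy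

end WeakGradient

/-! ### Softmin weights -/

section Softmin

variable {ι E : Type*}

/-- The weight of `z` in the softmin with parameter `p` of `0` and the numbers `κ j`, `j ∈ Z`. -/
def softWeight (Z : Finset ι) (p : ℝ) (κ : ι → ℝ) (z : ι) : ℝ :=
  Real.exp (-p * κ z) / (1 + ∑ j ∈ Z, Real.exp (-p * κ j))

theorem softWeight_denom_pos (Z : Finset ι) (p : ℝ) (κ : ι → ℝ) :
    0 < 1 + ∑ j ∈ Z, Real.exp (-p * κ j) :=
  add_pos_of_pos_of_nonneg one_pos (Finset.sum_nonneg fun _ _ => (Real.exp_pos _).le)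

theorem softWeight_nonneg (Z : Finset ι) (p : ℝ) (κ : ι → ℝ) (z : ι) : 0 ≤ softWeight Z p κ z :=
  div_nonneg (Real.exp_pos _).le (softWeight_denom_pos Z p κ).le

theorem sum_softWeight_le_one (Z : Finset ι) (p : ℝ) (κ : ι → ℝ) :
    ∑ z ∈ Z, softWeight Z p κ z ≤ 1 := by
  unfold softWeight
  rw [← Finset.sum_div, div_le_one (softWeight_denom_pos Z p κ)]
  linarith

theorem softWeight_le_one {Z : Finset ι} (p : ℝ) (κ : ι → ℝ) {z : ι} (hz : z ∈ Z) :
    softWeight Z p κ z ≤ 1 :=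
  (Finset.single_le_sum (fun j _ => softWeight_nonneg Z p κ j) hz).trans
    (sum_softWeight_le_one Z p κ)

/-- If all values are positive, the softmin weights tend to zero. -/
theorem tendsto_softWeight_of_pos {Z : Finset ι} {κ : ι → ℝ} {z : ι} (hz : 0 < κ z) :
    Tendsto (fun n : ℕ => softWeight Z n κ z) atTop (𝓝 0) := by
  have h : Tendsto (fun n : ℕ => Real.exp (-(n : ℝ) * κ z)) atTop (𝓝 0) := by
    refine Real.tendsto_exp_neg_atTop_nhds_zero.comp
      (tendsto_natCast_atTop_atTop.atTop_mul_const hz) |>.congr fun n => ?_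
    simp
  refine squeeze_zero (fun n => softWeight_nonneg Z n κ z) (fun n => ?_) h
  refine div_le_self (Real.exp_pos _).le ?_
  linarith [Finset.sum_nonneg fun j (_ : j ∈ Z) => (Real.exp_pos (-(n : ℝ) * κ j)).le]

/-- Only the term of `z₀` is kept in the denominator. A value strictly above another one thus gets
exponentially small weight in `p`. -/
theorem softWeight_le_exp {Z : Finset ι} {κ : ι → ℝ} {z₀ z : ι} (hz₀ : z₀ ∈ Z) (p : ℝ) :
    softWeight Z p κ z ≤ Real.exp (-p * (κ z - κ z₀)) := by
  unfold softWeight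
  rw [div_le_iff₀ (softWeight_denom_pos Z p κ)]
  have h1 := Finset.single_le_sum (fun j (_ : j ∈ Z) => (Real.exp_pos (-p * κ j)).le) hz₀
  calc Real.exp (-p * κ z) = Real.exp (-p * (κ z - κ z₀)) * Real.exp (-p * κ z₀) := by
        rw [← Real.exp_add]; ring_nf
    _ ≤ _ := by gcongr; linarith

/-- If the minimum is negative and attained only once, the weights concentrate at the minimum. -/
theorem tendsto_softWeight_of_min [DecidableEq ι] {Z : Finset ι} {κ : ι → ℝ} {z₀ : ι}
    (hz₀ : z₀ ∈ Z) (hneg : κ z₀ < 0) (hmin : ∀ z ∈ Z, z ≠ z₀ → κ z₀ < κ z) {z : ι} (hz : z ∈ Z) :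
    Tendsto (fun n : ℕ => softWeight Z n κ z) atTop (𝓝 (if z = z₀ then 1 else 0)) := by
  have hexp : ∀ {t : ℝ}, 0 < t → Tendsto (fun n : ℕ => Real.exp (-(n : ℝ) * t)) atTop (𝓝 0) := by
    intro t ht
    refine Real.tendsto_exp_neg_atTop_nhds_zero.comp
      (tendsto_natCast_atTop_atTop.atTop_mul_const ht) |>.congr fun n => ?_
    simp
  have hother : ∀ z ∈ Z, z ≠ z₀ → Tendsto (fun n : ℕ => softWeight Z n κ z) atTop (𝓝 0) :=
    fun z hz hne => squeeze_zero (fun n => softWeight_nonneg Z n κ z)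
      (fun n => softWeight_le_exp hz₀ n) (hexp (sub_pos.2 (hmin z hz hne)))
  split_ifs with h
  · subst h
    -- Together with `1 / D`, the weight of the competing value `0`, all weights sum to 1; the
    -- minimizer takes what the others leave.
    have hsum : ∀ n : ℕ, softWeight Z n κ z = 1 - 1 / (1 + ∑ j ∈ Z, Real.exp (-(n : ℝ) * κ j))
        - ∑ j ∈ Z.erase z, softWeight Z n κ j := by
      intro n
      have h1 : ∑ j ∈ Z, softWeight Z n κ j
          = 1 - 1 / (1 + ∑ j ∈ Z, Real.exp (-(n : ℝ) * κ j)) := by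
        unfold softWeight
        rw [← Finset.sum_div]
        have := (softWeight_denom_pos Z n κ).ne'
        field_simp
        ring
      rw [← h1, ← Finset.add_sum_erase _ _ hz]
      ring
    have hrest : Tendsto (fun n : ℕ => ∑ j ∈ Z.erase z, softWeight Z n κ j) atTop (𝓝 0) := by
      simpa using tendsto_finsetSum (Z.erase z) fun j hj =>
        hother j (Finset.mem_of_mem_erase hj) (Finset.ne_of_mem_erase hj)
    have hden : Tendsto (fun n : ℕ => 1 / (1 + ∑ j ∈ Z, Real.exp (-(n : ℝ) * κ j))) atTop
        (𝓝 0) := by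
      refine squeeze_zero (fun n => (one_div_pos.2 (softWeight_denom_pos Z n κ)).le) (fun n => ?_)
        (hexp (neg_pos.2 hneg))
      rw [div_le_iff₀ (softWeight_denom_pos Z n κ)]
      have h1 := Finset.single_le_sum (fun j (_ : j ∈ Z) => (Real.exp_pos (-(n : ℝ) * κ j)).le) hz
      calc (1 : ℝ) = Real.exp (-(n : ℝ) * -κ z) * Real.exp (-n * κ z) := by
            rw [← Real.exp_add]; simp
        _ ≤ _ := by gcongr; linarith
    simpa using ((tendsto_const_nhds.sub hden).sub hrest).congr fun n => (hsum n).symm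
  · exact hother z hz h

variable [NormedAddCommGroup E]

/-- The logarithmic derivative of a weight is `-p` times the deviation of `κ' z` from the weighted
mean. The constant value `0` adds nothing to this mean, though it counts in the normalization. -/
theorem hasFDerivAt_softWeight [NormedSpace ℝ E] (Z : Finset ι) (p : ℝ) {κ : ι → E → ℝ}
    {κ' : ι → E →L[ℝ] ℝ} {x : E} (hκ : ∀ z ∈ Z, HasFDerivAt (κ z) (κ' z) x) {z : ι} (hz : z ∈ Z) :
    HasFDerivAt (fun y => softWeight Z p (fun j => κ j y) z)
      ((-p * softWeight Z p (fun j => κ j x) z) •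
        (κ' z - ∑ j ∈ Z, softWeight Z p (fun j => κ j x) j • κ' j)) x := by
  have hE : ∀ j ∈ Z, HasFDerivAt (fun y => Real.exp (-p * κ j y))
      (Real.exp (-p * κ j x) • (-p) • κ' j) x := fun j hj => ((hκ j hj).const_mul (-p)).exp
  have hD : HasFDerivAt (fun y => 1 + ∑ j ∈ Z, Real.exp (-p * κ j y))
      (∑ j ∈ Z, Real.exp (-p * κ j x) • (-p) • κ' j) x :=
    (HasFDerivAt.fun_sum hE).const_add 1
  have hpos := softWeight_denom_pos Z p fun j => κ j x
  have h := (hE z hz).fun_mul ((hasDerivAt_inv hpos.ne').comp_hasFDerivAt x hD)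
  refine h.congr_fderiv ?_
  ext v
  simp only [softWeight, smul_apply, sub_apply, add_apply, sum_apply, smul_eq_mul,
    Function.comp_apply]
  set D := 1 + ∑ j ∈ Z, Real.exp (-p * κ j x) with hDdef
  have e1 : ∑ j ∈ Z, Real.exp (-p * κ j x) * (-p * κ' j v)
      = -p * ∑ j ∈ Z, Real.exp (-p * κ j x) * κ' j v := by
    rw [Finset.mul_sum]; exact Finset.sum_congr rfl fun j _ => by ring
  have e2 : ∑ j ∈ Z, Real.exp (-p * κ j x) / D * κ' j v
      = (∑ j ∈ Z, Real.exp (-p * κ j x) * κ' j v) / D := by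
    rw [Finset.sum_div]; exact Finset.sum_congr rfl fun j _ => by ring
  rw [e1, e2]
  field_simp
  ring

/-- Expanding the nonnegative sum `∑ w |Y - M|²` gives `∑ w |Y|² - (2 - ∑ w) |M|²`, and `2 - ∑ w ≥
1`. Total mass below 1 is allowed because the value `0` carries the rest. -/
theorem norm_sum_smul_sq_le [InnerProductSpace ℝ E] (Z : Finset ι) {w : ι → ℝ} (Y : ι → E)
    (hw : ∀ z ∈ Z, 0 ≤ w z) (hw1 : ∑ z ∈ Z, w z ≤ 1) :
    ‖∑ z ∈ Z, w z • Y z‖ ^ 2 ≤ ∑ z ∈ Z, w z * ‖Y z‖ ^ 2 := by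
  set M := ∑ z ∈ Z, w z • Y z with hM
  have h0 : 0 ≤ ∑ z ∈ Z, w z * ‖Y z - M‖ ^ 2 :=
    Finset.sum_nonneg fun z hz => mul_nonneg (hw z hz) (sq_nonneg _)
  have h1 : ∑ z ∈ Z, w z * ‖Y z - M‖ ^ 2
      = ∑ z ∈ Z, w z * ‖Y z‖ ^ 2 - 2 * ‖M‖ ^ 2 + (∑ z ∈ Z, w z) * ‖M‖ ^ 2 := by
    have h2 : ‖M‖ ^ 2 = ∑ z ∈ Z, w z * inner ℝ (Y z) M := by
      rw [← real_inner_self_eq_norm_sq]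
      conv_lhs => rw [hM, sum_inner]
      simp [real_inner_smul_left, hM]
    rw [show 2 * ‖M‖ ^ 2 = ∑ z ∈ Z, 2 * (w z * inner ℝ (Y z) M) by rw [← Finset.mul_sum, ← h2],
      Finset.sum_mul, ← Finset.sum_sub_distrib, ← Finset.sum_add_distrib]
    refine Finset.sum_congr rfl fun z _ => ?_
    rw [norm_sub_sq_real]; ring
  nlinarith [sq_nonneg ‖M‖]

/-- Softmin weights decrease along the gradients of the functions they belong to, on average. -/
theorem sum_softWeight_fderiv_nonpos [InnerProductSpace ℝ E] (Z : Finset ι) {p : ℝ} (hp : 0 ≤ p)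
    (κ : ι → ℝ) (Y : ι → E) :
    ∑ z ∈ Z, ((-p * softWeight Z p κ z) •
      (innerSL ℝ (Y z) - ∑ j ∈ Z, softWeight Z p κ j • innerSL ℝ (Y j))) (Y z) ≤ 0 := by
  have h := norm_sum_smul_sq_le Z Y (fun z _ => softWeight_nonneg Z p κ z)
    (sum_softWeight_le_one Z p κ)
  set w := softWeight Z p κ with hw
  -- Each derivative of a weight is paired with the same vector `Y z` that drives the weights. This
  -- match turns the sum into `-p` times a variance.
  have e : ∑ z ∈ Z, ((-p * w z) • (innerSL ℝ (Y z) - ∑ j ∈ Z, w j • innerSL ℝ (Y j))) (Y z)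
      = -p * (∑ z ∈ Z, w z * ‖Y z‖ ^ 2 - ‖∑ z ∈ Z, w z • Y z‖ ^ 2) := by
    rw [← real_inner_self_eq_norm_sq (∑ z ∈ Z, w z • Y z), inner_sum, mul_sub, Finset.mul_sum,
      Finset.mul_sum, ← Finset.sum_sub_distrib]
    refine Finset.sum_congr rfl fun z _ => ?_
    simp only [smul_apply, sub_apply, sum_apply, smul_eq_mul, innerSL_apply_apply,
      real_inner_self_eq_norm_sq, real_inner_smul_right, sum_inner, real_inner_smul_left,
      mul_sub, Finset.mul_sum]
    congr 1
    · ring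
    · exact Finset.sum_congr rfl fun j _ => by ring
  rw [e]
  nlinarith

end Softmin

/-! ### Testing a weak gradient with a softmin of radial fluxes -/

section SoftminFlux

/-- The divergence of the field `x ↦ η ρ² m(|x - z|²) (x - z)`. -/
def fluxDiv (ρ η : 𝔼 → ℝ) (m : ℝ → ℝ) (z x : 𝔼) : ℝ :=
  η x * ρ x ^ 2 * (d * m (‖x - z‖ ^ 2) + 2 * ‖x - z‖ ^ 2 * deriv m (‖x - z‖ ^ 2))
    + 2 * η x * ρ x * m (‖x - z‖ ^ 2) * inner ℝ (∇ ρ x) (x - z)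
    + ρ x ^ 2 * m (‖x - z‖ ^ 2) * inner ℝ (∇ η x) (x - z)

theorem inner_gradient_eq_fderiv (f : 𝔼 → ℝ) (x y : 𝔼) : inner ℝ (∇ f x) y = fderiv ℝ f x y := by
  simp [gradient]

theorem hasFDerivAt_norm_sub_sq (z x : 𝔼) :
    HasFDerivAt (fun y => ‖y - z‖ ^ 2) ((2 : ℝ) • innerSL ℝ (x - z)) x := by
  have := ((hasFDerivAt_id x).sub_const z).norm_sq
  refine this.congr_fderiv ?_
  ext v
  simp

theorem sum_fderiv_single_mul (x : 𝔼) (T : 𝔼 →L[ℝ] ℝ) :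
    ∑ k, T (EuclideanSpace.single k 1) * x k = T x := by
  conv_rhs => rw [← (EuclideanSpace.basisFun (Fin d) ℝ).sum_repr x]
  simp [mul_comm]

/-- The divergence of the field `∑ θ_z (x - z)`, in coordinates. -/
theorem sum_fderiv_sum_mul_sub (Z : Finset 𝔼) {θ : 𝔼 → 𝔼 → ℝ} {θ' : 𝔼 → 𝔼 →L[ℝ] ℝ} {x : 𝔼}
    (h : ∀ z ∈ Z, HasFDerivAt (θ z) (θ' z) x) :
    ∑ k, fderiv ℝ (fun y => ∑ z ∈ Z, θ z y * (y - z) k) x (EuclideanSpace.single k 1)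
      = ∑ z ∈ Z, (d * θ z x + θ' z (x - z)) := by
  have hc : ∀ k (z : 𝔼), HasFDerivAt (fun y : 𝔼 => (y - z) k)
      (EuclideanSpace.proj k : 𝔼 →L[ℝ] ℝ) x := fun k z =>
    (EuclideanSpace.proj k : 𝔼 →L[ℝ] ℝ).hasFDerivAt.comp x ((hasFDerivAt_id x).sub_const z)
  have hk : ∀ k, fderiv ℝ (fun y => ∑ z ∈ Z, θ z y * (y - z) k) x (EuclideanSpace.single k 1)
      = ∑ z ∈ Z, (θ z x + θ' z (EuclideanSpace.single k 1) * (x - z) k) := by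
    intro k
    rw [(HasFDerivAt.fun_sum fun z hz => (h z hz).fun_mul (hc k z)).fderiv]
    simp only [sum_apply, add_apply, smul_apply, smul_eq_mul]
    refine Finset.sum_congr rfl fun z _ => ?_
    simp [mul_comm]
  simp_rw [hk]
  rw [Finset.sum_comm]
  refine Finset.sum_congr rfl fun z _ => ?_
  rw [Finset.sum_add_distrib, sum_fderiv_single_mul]
  simp

/-- The divergence of a softmin of radial fluxes is at most the weighted mean of divergences. -/
theorem sum_fderiv_softmin_flux_le (Z : Finset 𝔼) {p : ℝ} (hp : 0 ≤ p) {ρ η : 𝔼 → ℝ}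
    {N m : ℝ → ℝ} {x : 𝔼} (hxZ : x ∉ Z) (hρ : DifferentiableAt ℝ ρ x)
    (hη : DifferentiableAt ℝ η x) (hη0 : 0 ≤ η x)
    (hN : ∀ q > 0, HasDerivAt N (m q / 2) q) (hm : ∀ q > 0, DifferentiableAt ℝ m q) :
    ∑ k, fderiv ℝ (fun y => ∑ z ∈ Z, η y * ρ y ^ 2 *
        (softWeight Z p (fun j => N (‖y - j‖ ^ 2)) z * m (‖y - z‖ ^ 2)) * (y - z) k) x
          (EuclideanSpace.single k 1)
      ≤ ∑ z ∈ Z, softWeight Z p (fun j => N (‖x - j‖ ^ 2)) z * fluxDiv ρ η m z x := by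
  have hq : ∀ z ∈ Z, 0 < ‖x - z‖ ^ 2 := fun z hz => by
    have : x - z ≠ 0 := sub_ne_zero.2 fun h => hxZ (h ▸ hz)
    positivity
  -- The normalization `N' = m / 2` makes the gradient of `N(|y - z|²)` equal to the flux `m (y -
  -- z)`, so the terms in which a weight is differentiated form the variance.
  have hκ : ∀ z ∈ Z, HasFDerivAt (fun y => N (‖y - z‖ ^ 2))
      (innerSL ℝ (m (‖x - z‖ ^ 2) • (x - z))) x := fun z hz => by
    refine ((hN _ (hq z hz)).comp_hasFDerivAt x (hasFDerivAt_norm_sub_sq z x)).congr_fderiv ?_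
    ext v
    simp only [smul_apply, smul_eq_mul, map_smul]
    ring
  have hmz : ∀ z ∈ Z, HasFDerivAt (fun y => m (‖y - z‖ ^ 2))
      (deriv m (‖x - z‖ ^ 2) • (2 : ℝ) • innerSL ℝ (x - z)) x := fun z hz =>
    (hm _ (hq z hz)).hasDerivAt.comp_hasFDerivAt x (hasFDerivAt_norm_sub_sq z x)
  have hρ2 : HasFDerivAt (fun y => ρ y ^ 2) ((2 * ρ x) • fderiv ℝ ρ x) x :=
    ((hasDerivAt_pow 2 (ρ x)).comp_hasFDerivAt x hρ.hasFDerivAt).congr_fderiv (by simp)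
  have hηρ := hη.hasFDerivAt.fun_mul hρ2
  have hθ := fun z hz => hηρ.fun_mul ((hasFDerivAt_softWeight Z p hκ hz).fun_mul (hmz z hz))
  rw [sum_fderiv_sum_mul_sub Z hθ]
  have hcov := sum_softWeight_fderiv_nonpos Z hp (fun j => N (‖x - j‖ ^ 2))
    fun z => m (‖x - z‖ ^ 2) • (x - z)
  have hηρ0 : 0 ≤ η x * ρ x ^ 2 := by positivity
  have hcov' := mul_nonpos_of_nonneg_of_nonpos hηρ0 hcov
  rw [Finset.mul_sum] at hcov'
  rw [← sub_nonpos, ← Finset.sum_sub_distrib]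
  refine (le_of_eq (Finset.sum_congr rfl fun z hz => ?_)).trans hcov'
  simp only [fluxDiv, inner_gradient_eq_fderiv]
  simp only [smul_apply, add_apply, smul_eq_mul, map_smul, innerSL_apply_apply,
    real_inner_self_eq_norm_sq]
  ring

theorem integrableOn_of_tsupport {F : Type*} [NormedAddCommGroup F] {f : 𝔼 → F} {K U : Set 𝔼}
    (hU : MeasurableSet U) (hf : IntegrableOn f K) (h0 : ∀ x ∉ K, f x = 0) : IntegrableOn f U :=
  hf.of_forall_sdiff_eq_zero hU fun x hx => h0 x hx.2

theorem measurable_gradient (f : 𝔼 → ℝ) : Measurable (∇ f) :=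
  (InnerProductSpace.toDual ℝ 𝔼).symm.continuous.measurable.comp (measurable_fderiv ℝ f)

theorem gradient_eq_zero_of_notMem_tsupport {f : 𝔼 → ℝ} {x : 𝔼} (hx : x ∉ tsupport f) :
    ∇ f x = 0 := by
  have : x ∉ tsupport (fderiv ℝ f) := fun h => hx (tsupport_fderiv_subset ℝ h)
  simp [gradient, image_eq_zero_of_notMem_tsupport this]

theorem exists_gradient_bound {f : 𝔼 → ℝ} {K U : Set 𝔼} (hK : IsCompact K) (hU : IsOpen U)
    (hKU : K ⊆ U) (hf : LocallyLipschitzOn U f) : ∃ C, ∀ x ∈ K, ‖∇ f x‖ ≤ C := by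
  obtain ⟨F, C, hF, hFf⟩ := exists_lipschitzWith_eq_near hK hU hKU hf
  refine ⟨C, fun x hx => ?_⟩
  have : F =ᶠ[𝓝 x] f := hFf.filter_mono (nhds_le_nhdsSet hx)
  rw [gradient, LinearIsometryEquiv.norm_map, ← this.fderiv_eq]
  exact norm_fderiv_le_of_lipschitz ℝ hF

theorem integrableOn_inner_gradient {f a : 𝔼 → ℝ} {b : 𝔼 → 𝔼} {K U : Set 𝔼} (hK : IsCompact K)
    (hU : IsOpen U) (hKU : K ⊆ U) (hf : LocallyLipschitzOn U f) (ha : ContinuousOn a K)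
    (hb : ContinuousOn b K) : IntegrableOn (fun x => a x * inner ℝ (∇ f x) (b x)) K := by
  obtain ⟨C, hC⟩ := exists_gradient_bound hK hU hKU hf
  obtain ⟨P, hP⟩ := hK.exists_bound_of_continuousOn hb
  have h : IntegrableOn (fun x => inner ℝ (∇ f x) (b x)) K := by
    refine Integrable.mono' (integrableOn_const hK.measure_lt_top.ne (C := C * P))
      ((measurable_gradient f).aestronglyMeasurable.inner
        (hb.aestronglyMeasurable hK.measurableSet))
      (ae_restrict_of_forall_mem hK.measurableSet fun x hx => ?_)
    exact (norm_inner_le_norm _ _).trans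
      (mul_le_mul (hC x hx) (hP x hx) (norm_nonneg _) ((norm_nonneg _).trans (hC x hx)))
  exact h.continuousOn_mul ha hK

theorem integrableOn_inner_of_continuousOn {b h : 𝔼 → 𝔼} {K : Set 𝔼} (hK : IsCompact K)
    (hh : IntegrableOn h K) (hb : ContinuousOn b K) :
    IntegrableOn (fun x => inner ℝ (b x) (h x)) K := by
  obtain ⟨P, hP⟩ := hK.exists_bound_of_continuousOn hb
  refine Integrable.mono' (hh.norm.const_mul P)
    ((hb.aestronglyMeasurable hK.measurableSet).inner hh.aestronglyMeasurable)
    (ae_restrict_of_forall_mem hK.measurableSet fun x hx => ?_)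
  exact (norm_inner_le_norm _ _).trans (by gcongr; exact hP x hx)

end SoftminFlux

/-! ### Integrated softmin flux inequality and its limit -/

section SoftminFluxIntegral

theorem contDiffOn_comp_norm_sub_sq {N : ℝ → ℝ} {U : Set 𝔼} {z : 𝔼} (hz : z ∉ U)
    (hN : ContDiffOn ℝ 1 N (Ioi 0)) : ContDiffOn ℝ 1 (fun x => N (‖x - z‖ ^ 2)) U := by
  refine hN.comp (((contDiff_id.sub contDiff_const).norm_sq ℝ).contDiffOn) fun x hx => ?_
  have : x - z ≠ 0 := sub_ne_zero.2 fun h => hz (h ▸ hx)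
  simp only [mem_Ioi]
  positivity

theorem contDiffOn_softWeight {N : ℝ → ℝ} {U : Set 𝔼} {Z : Finset 𝔼} (hZ : ∀ z ∈ Z, z ∉ U)
    (hN : ContDiffOn ℝ 1 N (Ioi 0)) (p : ℝ) {z : 𝔼} (hz : z ∈ Z) :
    ContDiffOn ℝ 1 (fun x => softWeight Z p (fun j => N (‖x - j‖ ^ 2)) z) U := by
  have h : ∀ j ∈ Z, ContDiffOn ℝ 1 (fun x => Real.exp (-p * N (‖x - j‖ ^ 2))) U := fun j hj =>
    (contDiffOn_const.mul (contDiffOn_comp_norm_sub_sq (hZ j hj) hN)).exp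
  exact (h z hz).div (contDiffOn_const.add (ContDiffOn.sum h))
    fun x _ => (softWeight_denom_pos Z p _).ne'

variable {U : Set (EuclideanSpace ℝ (Fin d))} {Z : Finset (EuclideanSpace ℝ (Fin d))}
  {ρ η v : EuclideanSpace ℝ (Fin d) → ℝ}
  {h : EuclideanSpace ℝ (Fin d) → EuclideanSpace ℝ (Fin d)} {N m : ℝ → ℝ}

theorem integrableOn_flux (hU : IsOpen U) (hZ : ∀ z ∈ Z, z ∉ U) (hρ : LocallyLipschitzOn U ρ)
    (hη : ContDiff ℝ ∞ η) (hηc : HasCompactSupport η) (hηU : tsupport η ⊆ U)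
    (hvh : HasWeakGradientOn v h U) (hm : ContDiffOn ℝ 1 m (Ioi 0)) {z : 𝔼} (hz : z ∈ Z) :
    IntegrableOn (fun x => η x * ρ x ^ 2 * m (‖x - z‖ ^ 2) * inner ℝ (x - z) (h x)) U := by
  have hK : IsCompact (tsupport η) := hηc
  refine integrableOn_of_tsupport (K := tsupport η) hU.measurableSet ?_
    fun x hx => by simp [image_eq_zero_of_notMem_tsupport hx]
  have hb : ContinuousOn (fun x => (η x * ρ x ^ 2 * m (‖x - z‖ ^ 2)) • (x - z)) (tsupport η) :=
    ((hη.continuous.continuousOn.mul ((hρ.continuousOn.mono hηU).pow 2)).mul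
      ((contDiffOn_comp_norm_sub_sq (hZ z hz) hm).continuousOn.mono hηU)).smul
      (continuous_id.sub continuous_const).continuousOn
  have := integrableOn_inner_of_continuousOn hK
    (hvh.locallyIntegrable_grad.integrableOn_compact_subset hηU hK) hb
  simpa only [real_inner_smul_left] using this

theorem integrableOn_mul_fluxDiv (hU : IsOpen U) (hZ : ∀ z ∈ Z, z ∉ U)
    (hρ : LocallyLipschitzOn U ρ)
    (hη : ContDiff ℝ ∞ η) (hηc : HasCompactSupport η) (hηU : tsupport η ⊆ U)
    (hv : ContinuousOn v U) (hm : ContDiffOn ℝ 1 m (Ioi 0)) {z : 𝔼} (hz : z ∈ Z) :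
    IntegrableOn (fun x => v x * fluxDiv ρ η m z x) U := by
  have hK : IsCompact (tsupport η) := hηc
  refine integrableOn_of_tsupport (K := tsupport η) hU.measurableSet ?_ fun x hx => by
    simp [fluxDiv, image_eq_zero_of_notMem_tsupport hx, gradient_eq_zero_of_notMem_tsupport hx]
  have hvK := hv.mono hηU
  have hηK : ContinuousOn η (tsupport η) := hη.continuous.continuousOn
  have hρK := hρ.continuousOn.mono hηU
  have hmK := (contDiffOn_comp_norm_sub_sq (hZ z hz) hm).continuousOn.mono hηU
  have hqK : ContinuousOn (fun x => ‖x - z‖ ^ 2) (tsupport η) := by fun_prop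
  have hyK : ContinuousOn (fun x => x - z) (tsupport η) := by fun_prop
  have hdm : ContinuousOn (deriv m) (Ioi 0) := hm.continuousOn_deriv_of_isOpen isOpen_Ioi le_rfl
  have hdmK : ContinuousOn (fun x => deriv m (‖x - z‖ ^ 2)) (tsupport η) := by
    refine hdm.comp hqK fun x hx => ?_
    have : x - z ≠ 0 := sub_ne_zero.2 fun h => hZ z hz (h ▸ hηU hx)
    simp only [mem_Ioi]
    positivity
  have h1 : IntegrableOn (fun x => v x * (η x * ρ x ^ 2 * (d * m (‖x - z‖ ^ 2)
      + 2 * ‖x - z‖ ^ 2 * deriv m (‖x - z‖ ^ 2)))) (tsupport η) :=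
    ContinuousOn.integrableOn_compact hK (hvK.mul ((hηK.mul (hρK.pow 2)).mul
      ((continuousOn_const.mul hmK).add ((continuousOn_const.mul hqK).mul hdmK))))
  have h2 := integrableOn_inner_gradient hK hU hηU hρ
    (a := fun x => v x * (2 * η x * ρ x * m (‖x - z‖ ^ 2)))
    (hvK.mul (((continuousOn_const.mul hηK).mul hρK).mul hmK)) hyK
  have h3 := integrableOn_inner_gradient hK hU hηU
    ((hη.of_le (by simp)).contDiffOn.locallyLipschitzOn_of_isOpen hU)
    (a := fun x => v x * (ρ x ^ 2 * m (‖x - z‖ ^ 2))) (hvK.mul ((hρK.pow 2).mul hmK)) hyK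
  refine ((h1.add h2).add h3).congr_fun (fun x _ => ?_) hK.measurableSet
  simp only [fluxDiv, Pi.add_apply]
  ring

/-- The coordinates of the flux field are compactly supported and locally Lipschitz, hence
admissible against the weak gradient of `v`; summing over coordinates yields `-∫ v div`. As `v ≥ 0`,
the pointwise divergence bound finishes; it is needed only where `ρ` is differentiable, that is
almost everywhere. -/
theorem integral_softWeight_flux_ge (hU : IsOpen U) (hZ : ∀ z ∈ Z, z ∉ U)
    (hρ : LocallyLipschitzOn U ρ)
    (hη : ContDiff ℝ ∞ η) (hηc : HasCompactSupport η) (hηU : tsupport η ⊆ U) (hη0 : ∀ x, 0 ≤ η x)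
    (hv : ContinuousOn v U) (hv0 : ∀ x, 0 ≤ v x) (hvh : HasWeakGradientOn v h U)
    (hN : ContDiffOn ℝ 1 N (Ioi 0)) (hN' : ∀ q > 0, HasDerivAt N (m q / 2) q)
    (hm : ContDiffOn ℝ 1 m (Ioi 0)) {p : ℝ} (hp : 0 ≤ p) :
    -∫ x in U, ∑ z ∈ Z,
        softWeight Z p (fun j => N (‖x - j‖ ^ 2)) z * (v x * fluxDiv ρ η m z x)
      ≤ ∫ x in U, ∑ z ∈ Z, softWeight Z p (fun j => N (‖x - j‖ ^ 2)) z *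
        (η x * ρ x ^ 2 * m (‖x - z‖ ^ 2) * inner ℝ (x - z) (h x)) := by
  have hK : IsCompact (tsupport η) := hηc
  set w : 𝔼 → 𝔼 → ℝ := fun z x => softWeight Z p (fun j => N (‖x - j‖ ^ 2)) z with hw
  have hwU : ∀ z ∈ Z, ContDiffOn ℝ 1 (w z) U := fun z hz => contDiffOn_softWeight hZ hN p hz
  have hmU : ∀ z ∈ Z, ContDiffOn ℝ 1 (fun x => m (‖x - z‖ ^ 2)) U := fun z hz =>
    contDiffOn_comp_norm_sub_sq (hZ z hz) hm
  have hwb : ∀ z ∈ Z, ∀ x, ‖w z x‖ ≤ 1 := fun z hz x => by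
    rw [Real.norm_of_nonneg (softWeight_nonneg _ _ _ _)]
    exact softWeight_le_one _ _ hz
  set ψ : Fin d → 𝔼 → ℝ := fun k y =>
    ∑ z ∈ Z, η y * ρ y ^ 2 * (w z y * m (‖y - z‖ ^ 2)) * (y - z) k with hψ
  have hψe : ∀ k, ψ k = fun y =>
      η y * (ρ y * ρ y * ∑ z ∈ Z, w z y * m (‖y - z‖ ^ 2) * (y - z) k) := by
    intro k
    ext y
    simp only [hψ, Finset.mul_sum]
    exact Finset.sum_congr rfl fun z _ => by ring
  have hψlip : ∀ k, LocallyLipschitzOn U (ψ k) := by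
    intro k
    rw [hψe k]
    refine locallyLipschitzOn_mul
      ((hη.of_le (by simp)).contDiffOn.locallyLipschitzOn_of_isOpen hU)
      (locallyLipschitzOn_mul (locallyLipschitzOn_mul hρ hρ) ?_)
    refine ContDiffOn.locallyLipschitzOn_of_isOpen (ContDiffOn.sum fun z hz => ?_) hU
    exact ((hwU z hz).mul (hmU z hz)).mul (by fun_prop)
  have hψs : ∀ k, tsupport (ψ k) ⊆ tsupport η := fun k => by
    rw [hψe k]; exact tsupport_mul_subset_left
  have hψc : ∀ k, HasCompactSupport (ψ k) := fun k =>
    hK.of_isClosed_subset (isClosed_tsupport _) (hψs k)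
  have hgK := hvh.locallyIntegrable_grad.integrableOn_compact_subset hηU hK
  have hibp := fun k => hvh.integral_eq_of_locallyLipschitz hU hv (hψlip k) (hψc k)
    ((hψs k).trans hηU) (EuclideanSpace.single k 1)
  have hi1 : ∀ k, IntegrableOn (fun x => ψ k x * inner ℝ (h x) (EuclideanSpace.single k 1)) U := by
    intro k
    refine integrableOn_of_tsupport (K := tsupport η) hU.measurableSet ?_ fun x hx => by
      simp [hψe k, image_eq_zero_of_notMem_tsupport hx]
    have : IntegrableOn (fun x => inner ℝ (h x) (EuclideanSpace.single k (1 : ℝ))) (tsupport η) :=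
      hgK.inner_const _
    exact this.continuousOn_mul ((hψlip k).continuousOn.mono hηU) hK
  have hi2 : ∀ k, IntegrableOn (fun x => v x * fderiv ℝ (ψ k) x (EuclideanSpace.single k 1)) U := by
    intro k
    refine integrableOn_of_tsupport (K := tsupport η) hU.measurableSet ?_ fun x hx => by
      rw [← inner_gradient_eq_fderiv,
        gradient_eq_zero_of_notMem_tsupport fun hx' => hx (hψs k hx')]
      simp
    simp only [← inner_gradient_eq_fderiv]
    exact integrableOn_inner_gradient hK hU hηU (hψlip k) (hv.mono hηU) continuousOn_const
  have hdiv : ∫ x in U, ∑ z ∈ Z, w z x * (η x * ρ x ^ 2 * m (‖x - z‖ ^ 2) * inner ℝ (x - z) (h x))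
      = -∫ x in U, v x * ∑ k, fderiv ℝ (ψ k) x (EuclideanSpace.single k 1) := by
    simp only [Finset.mul_sum]
    rw [integral_finsetSum _ fun k _ => hi2 k, Finset.sum_congr rfl fun k _ => hibp k,
      Finset.sum_neg_distrib, neg_neg, ← integral_finsetSum _ fun k _ => hi1 k]
    congr 1
    ext x
    simp only [hψ, Finset.sum_mul]
    rw [Finset.sum_comm]
    refine Finset.sum_congr rfl fun z _ => ?_
    have : inner ℝ (x - z) (h x) = ∑ k, (x - z) k * h x k := by
      simp [PiLp.inner_apply, mul_comm]
    rw [this, Finset.mul_sum, Finset.mul_sum]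
    refine Finset.sum_congr rfl fun k _ => ?_
    simp [EuclideanSpace.inner_single_right]
    ring
  rw [hdiv]
  refine neg_le_neg (integral_mono_ae ?_ ?_ ?_)
  · simp only [Finset.mul_sum]
    exact integrable_finsetSum _ fun k _ => hi2 k
  · refine integrable_finsetSum _ fun z hz => ?_
    exact (integrableOn_mul_fluxDiv hU hZ hρ hη hηc hηU hv hm hz).bdd_mul
      ((hwU z hz).continuousOn.aestronglyMeasurable hU.measurableSet)
      (Eventually.of_forall (hwb z hz))
  · refine (ae_restrict_iff' hU.measurableSet).2 ?_
    filter_upwards [ae_differentiableAt_of_locallyLipschitzOn hK hU hηU hρ] with x hxρ hxU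
    have hrw : ∑ z ∈ Z, w z x * (v x * fluxDiv ρ η m z x)
        = v x * ∑ z ∈ Z, w z x * fluxDiv ρ η m z x := by
      rw [Finset.mul_sum]
      exact Finset.sum_congr rfl fun z _ => by ring
    rw [hrw]
    refine mul_le_mul_of_nonneg_left ?_ (hv0 x)
    by_cases hx : x ∈ tsupport η
    · exact sum_fderiv_softmin_flux_le Z hp (fun hxZ => hZ x hxZ hxU) (hxρ hx)
        (hη.differentiable (by simp) x) (hη0 x) hN' fun q hq =>
          (hm.contDiffAt (Ioi_mem_nhds hq)).differentiableAt one_ne_zero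
    · refine le_of_eq ?_
      rw [Finset.sum_eq_zero fun k _ => by
          rw [← inner_gradient_eq_fderiv,
            gradient_eq_zero_of_notMem_tsupport fun hx' => hx (hψs k hx'), inner_zero_left],
        Finset.sum_eq_zero fun z _ => by
          simp [fluxDiv, image_eq_zero_of_notMem_tsupport hx,
            gradient_eq_zero_of_notMem_tsupport hx]]

/-- Limit form: if the softmin weights converge a.e. to `W`, the field
`∑ W_z ρ² m(|x - z|²) (x - z)` has in the weak sense at most the divergence `∑ W_z fluxDiv_z`. -/
theorem integral_limit_flux_ge (hU : IsOpen U) (hZ : ∀ z ∈ Z, z ∉ U)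
    (hρ : LocallyLipschitzOn U ρ)
    (hη : ContDiff ℝ ∞ η) (hηc : HasCompactSupport η) (hηU : tsupport η ⊆ U) (hη0 : ∀ x, 0 ≤ η x)
    (hv : ContinuousOn v U) (hv0 : ∀ x, 0 ≤ v x) (hvh : HasWeakGradientOn v h U)
    (hN : ContDiffOn ℝ 1 N (Ioi 0)) (hN' : ∀ q > 0, HasDerivAt N (m q / 2) q)
    (hm : ContDiffOn ℝ 1 m (Ioi 0)) {W : 𝔼 → 𝔼 → ℝ}
    (hW : ∀ᵐ x ∂volume.restrict U, ∀ z ∈ Z,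
      Tendsto (fun n : ℕ => softWeight Z n (fun j => N (‖x - j‖ ^ 2)) z) atTop (𝓝 (W z x))) :
    -∫ x in U, ∑ z ∈ Z, W z x * (v x * fluxDiv ρ η m z x)
      ≤ ∫ x in U, ∑ z ∈ Z, W z x *
        (η x * ρ x ^ 2 * m (‖x - z‖ ^ 2) * inner ℝ (x - z) (h x)) := by
  -- The weights stay in `[0, 1]`, so `∑ ‖F z‖` dominates for all `n`. No derivative of a weight is
  -- left in either integrand, so both sides converge.
  have key : ∀ F : 𝔼 → 𝔼 → ℝ, (∀ z ∈ Z, IntegrableOn (F z) U) →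
      Tendsto (fun n : ℕ => ∫ x in U, ∑ z ∈ Z,
        softWeight Z n (fun j => N (‖x - j‖ ^ 2)) z * F z x) atTop
        (𝓝 (∫ x in U, ∑ z ∈ Z, W z x * F z x)) := by
    intro F hF
    refine tendsto_integral_filter_of_dominated_convergence (fun x => ∑ z ∈ Z, ‖F z x‖) ?_ ?_
      (integrable_finsetSum _ fun z hz => (hF z hz).norm) ?_
    · refine Eventually.of_forall fun n => Finset.aestronglyMeasurable_fun_sum _ fun z hz => ?_
      exact ((contDiffOn_softWeight hZ hN n hz).continuousOn.aestronglyMeasurable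
        hU.measurableSet).mul (hF z hz).aestronglyMeasurable
    · refine Eventually.of_forall fun n => Eventually.of_forall fun x => ?_
      refine (norm_sum_le _ _).trans (Finset.sum_le_sum fun z hz => ?_)
      rw [norm_mul, Real.norm_of_nonneg (softWeight_nonneg _ _ _ _)]
      exact mul_le_of_le_one_left (norm_nonneg _) (softWeight_le_one _ _ hz)
    · filter_upwards [hW] with x hx
      exact tendsto_finsetSum _ fun z hz => (hx z hz).mul_const _
  exact le_of_tendsto_of_tendsto'
    (key _ fun z hz => integrableOn_mul_fluxDiv hU hZ hρ hη hηc hηU hv hm hz).neg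
    (key _ fun z hz => integrableOn_flux hU hZ hρ hη hηc hηU hvh hm hz)
    fun n => integral_softWeight_flux_ge hU hZ hρ hη hηc hηU hη0 hv hv0 hvh hN hN' hm
      (Nat.cast_nonneg n)

end SoftminFluxIntegral

/-! ### The radial barrier -/

section Barrier

/-- The flux of the barrier `-c |x - z|^β` weighted by `1 + |x - z|^(-α)` is
`-fluxCoeff(|x - z|²) (x - z)`. -/
def fluxCoeff (α β c q : ℝ) : ℝ := c * β * (q ^ ((β - 2) / 2) + q ^ ((β - 2 - α) / 2))

theorem contDiffOn_fluxCoeff (α β c : ℝ) : ContDiffOn ℝ 1 (fluxCoeff α β c) (Ioi 0) := by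
  intro q hq
  have hq' : q ≠ 0 := (mem_Ioi.1 hq).ne'
  exact (contDiffAt_const.mul ((Real.contDiffAt_rpow_const_of_ne hq').add
    (Real.contDiffAt_rpow_const_of_ne hq'))).contDiffWithinAt

theorem fluxCoeff_pos {α β c q : ℝ} (hβ : 0 < β) (hc : 0 < c) (hq : 0 < q) :
    0 < fluxCoeff α β c q := by
  unfold fluxCoeff; positivity

theorem sq_rpow_half {t : ℝ} (ht : 0 < t) (a : ℝ) : (t ^ 2) ^ (a / 2) = t ^ a := by
  rw [← Real.rpow_natCast, ← Real.rpow_mul ht.le]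
  congr 1
  push_cast
  ring

theorem fluxCoeff_sq {α β c t : ℝ} (ht : 0 < t) :
    fluxCoeff α β c (t ^ 2) = c * β * t ^ (β - 2 - α) * (1 + t ^ α) := by
  rw [fluxCoeff, sq_rpow_half ht, sq_rpow_half ht, show β - 2 = β - 2 - α + α by ring,
    Real.rpow_add ht, show β - 2 - α + α - α = β - 2 - α by ring]
  ring

/-- The powers `t^(β-2-α)` and `t^(β-2)` produce the factors `D + β - 2 - α = -β` and `D + β - 2 = α
- β`. The first, dominant as `t → 0` when `α > 0`, is negative by the choice of `β`. -/
theorem fluxCoeff_div {α β c D t : ℝ} (hβ : 2 * β = α + 2 - D) (ht : 0 < t) :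
    D * fluxCoeff α β c (t ^ 2) + 2 * t ^ 2 * deriv (fluxCoeff α β c) (t ^ 2)
      = c * β * t ^ (β - 2 - α) * ((α - β) * t ^ α - β) := by
  have hq : t ^ 2 ≠ 0 := by positivity
  have hd : HasDerivAt (fluxCoeff α β c) (c * β * ((β - 2) / 2 * (t ^ 2) ^ ((β - 2) / 2 - 1)
      + (β - 2 - α) / 2 * (t ^ 2) ^ ((β - 2 - α) / 2 - 1))) (t ^ 2) :=
    ((Real.hasDerivAt_rpow_const (Or.inl hq)).add
      (Real.hasDerivAt_rpow_const (Or.inl hq))).const_mul (c * β)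
  have hE : t ^ (β - 2) = t ^ (β - 2 - α) * t ^ α := by
    rw [← Real.rpow_add ht]; congr 1; ring
  have hD : D = α + 2 - 2 * β := by linarith
  rw [hd.deriv, fluxCoeff_sq ht, Real.rpow_sub_one hq, Real.rpow_sub_one hq, sq_rpow_half ht,
    sq_rpow_half ht, hE, hD]
  field_simp
  ring

/-- Each term is moved from `t` to `R` by monotonicity. For negative `α` the power decreases but its
coefficient is negative too, so `α t^α ≤ α R^α` in both cases; `-1 < α` makes `t^(1+α)` increasing.
The term `-β t^α` is discarded. -/
theorem radial_bracket_le {α β R Λ t : ℝ} (hβ0 : 0 < β) (hα : -1 < α) (hΛ : 0 ≤ Λ) (ht : 0 < t)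
    (htR : t ≤ R) (h : 2 * Λ * R * (1 + R ^ α) + α * R ^ α ≤ β / 2) :
    (α - β) * t ^ α - β + 2 * Λ * t * (1 + t ^ α) ≤ -(β / 2) := by
  have hR : 0 < R := ht.trans_le htR
  have h1 : α * t ^ α ≤ α * R ^ α := by
    rcases le_total 0 α with h0 | h0
    · exact mul_le_mul_of_nonneg_left (Real.rpow_le_rpow ht.le htR h0) h0
    · exact mul_le_mul_of_nonpos_left (Real.rpow_le_rpow_of_nonpos ht htR h0) h0
  have h2 : t * t ^ α ≤ R * R ^ α := by
    rw [← Real.rpow_one_add' ht.le (by linarith), ← Real.rpow_one_add' hR.le (by linarith)]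
    exact Real.rpow_le_rpow ht.le htR (by linarith)
  have h3 : Λ * (t * (1 + t ^ α)) ≤ Λ * (R * (1 + R ^ α)) :=
    mul_le_mul_of_nonneg_left (by linarith) hΛ
  have h4 : 0 < β * t ^ α := mul_pos hβ0 (Real.rpow_pos_of_pos ht _)
  nlinarith

/-- Divergence and drift together are at most `-ρ² c β² P / 2` with `P = t^(-(β+D))`, by the bracket
bound. Since `t ≤ R ≤ 1`, one has `R^β t^(β+D) ≤ R^D`, so the assumption on `τ R^D` lets this
dominate the zeroth-order term; `4/9 ≤ 1/2` leaves room. -/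
theorem flux_inequality {α β D R Λ t τ ρ I : ℝ} (hβ : 2 * β = α + 2 - D) (hβ0 : 0 < β)
    (hα : -1 < α) (hD : 0 ≤ D) (hΛ : 0 ≤ Λ) (hτ : 0 ≤ τ) (hρ : 0 < ρ) (ht : 0 < t) (htR : t ≤ R)
    (hR1 : R ≤ 1) (h : 2 * Λ * R * (1 + R ^ α) + α * R ^ α ≤ β / 2) (hI : I ≤ ρ * Λ * t)
    (hτR : τ * R ^ D ≤ 4 / 9 * β ^ 2 * ρ) :
    ρ ^ 2 * (D * fluxCoeff α β (R ^ (-β)) (t ^ 2)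
        + 2 * t ^ 2 * deriv (fluxCoeff α β (R ^ (-β))) (t ^ 2))
      + 2 * ρ * fluxCoeff α β (R ^ (-β)) (t ^ 2) * I
      ≤ -(τ * ρ * (R ^ (-β) * (R ^ β - t ^ β))) := by
  have hR : 0 < R := ht.trans_le htR
  have hc : 0 < R ^ (-β) := Real.rpow_pos_of_pos hR _
  set c := R ^ (-β) with hcdef
  have hbr := radial_bracket_le hβ0 hα hΛ ht htR h
  have hm := fluxCoeff_pos (α := α) hβ0 hc (sq_pos_of_pos ht)
  rw [fluxCoeff_div hβ ht]
  have hI' : 2 * ρ * fluxCoeff α β c (t ^ 2) * I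
      ≤ 2 * ρ * fluxCoeff α β c (t ^ 2) * (ρ * Λ * t) := by gcongr
  rw [fluxCoeff_sq ht] at hI' ⊢
  set P := t ^ (β - 2 - α) with hP
  have hP0 : 0 < P := Real.rpow_pos_of_pos ht _
  have h1 : ρ ^ 2 * (c * β * P) * ((α - β) * t ^ α - β + 2 * Λ * t * (1 + t ^ α))
      ≤ ρ ^ 2 * (c * β * P) * -(β / 2) := by gcongr
  have hkey : τ * R ^ β ≤ ρ * β ^ 2 / 2 * P := by
    have e1 : P * t ^ (β + D) = 1 := by
      rw [hP, ← Real.rpow_add ht, show β - 2 - α + (β + D) = 0 by linarith, Real.rpow_zero]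
    have e2 : R ^ β * t ^ (β + D) ≤ R ^ D := by
      calc R ^ β * t ^ (β + D) ≤ R ^ β * R ^ (β + D) := by gcongr
        _ = R ^ (2 * β) * R ^ D := by
          rw [← Real.rpow_add hR, ← Real.rpow_add hR]; congr 1; ring
        _ ≤ 1 * R ^ D := by
          gcongr
          exact Real.rpow_le_one hR.le hR1 (by linarith)
        _ = R ^ D := one_mul _
    have e3 : τ * (R ^ β * t ^ (β + D)) ≤ ρ * β ^ 2 / 2 := by
      calc τ * (R ^ β * t ^ (β + D)) ≤ τ * R ^ D := by gcongr
        _ ≤ 4 / 9 * β ^ 2 * ρ := hτR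
        _ ≤ ρ * β ^ 2 / 2 := by nlinarith [mul_pos (sq_pos_of_pos hβ0) hρ]
    calc τ * R ^ β = τ * R ^ β * (P * t ^ (β + D)) := by rw [e1, mul_one]
      _ = τ * (R ^ β * t ^ (β + D)) * P := by ring
      _ ≤ ρ * β ^ 2 / 2 * P := by gcongr
  have h2 : ρ * c * (τ * (R ^ β - t ^ β)) ≤ ρ * c * (ρ * β ^ 2 / 2 * P) := by
    have : 0 ≤ τ * t ^ β := by positivity
    exact mul_le_mul_of_nonneg_left (by linarith) (by positivity)
  linarith

/-- A positive continuous function on `(0, ∞)` has an increasing primitive vanishing at `a`. -/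
theorem exists_primitive {m : ℝ → ℝ} (hm : ContinuousOn m (Ioi 0)) (hpos : ∀ q > 0, 0 < m q) {a : ℝ}
    (ha : 0 < a) :
    ∃ N : ℝ → ℝ, ContDiffOn ℝ 1 N (Ioi 0) ∧ (∀ q > 0, HasDerivAt N (m q / 2) q) ∧
      StrictMonoOn N (Ioi 0) ∧ N a = 0 := by
  have hm2 : ContinuousOn (fun q => m q / 2) (Ioi 0) := hm.div_const 2
  have hder : ∀ q > 0, HasDerivAt (fun q => ∫ t in a..q, m t / 2) (m q / 2) q := by
    intro q hq
    refine intervalIntegral.integral_hasDerivAt_right ?_ ?_ (hm2.continuousAt (Ioi_mem_nhds hq))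
    · exact (hm2.mono ((ordConnected_Ioi.uIcc_subset ha hq))).intervalIntegrable
    · exact hm2.stronglyMeasurableAtFilter isOpen_Ioi q hq
  refine ⟨_, ?_, hder, ?_, intervalIntegral.integral_same⟩
  · refine (contDiffOn_succ_iff_deriv_of_isOpen (n := 0) isOpen_Ioi).2 ⟨fun q hq =>
      (hder q hq).differentiableAt.differentiableWithinAt, by simp, ?_⟩
    rw [contDiffOn_zero]
    exact hm2.congr fun q hq => (hder q hq).deriv
  · refine strictMonoOn_of_deriv_pos (convex_Ioi 0)
      (fun q hq => (hder q hq).continuousAt.continuousWithinAt) fun q hq => ?_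
    rw [interior_Ioi] at hq
    rw [(hder q hq).deriv]
    exact half_pos (hpos q hq)

end Barrier

/-! ### The barrier, its gradient, and nearest labels -/

section BarrierGeometry

/-- The barrier `(c (s^β - dist(x, Z)^β))⁺`. -/
def barrier (Z : Set 𝔼) (β c s : ℝ) (x : 𝔼) : ℝ := max 0 (c * (s ^ β - infDist x Z ^ β))

theorem continuous_barrier (Z : Set 𝔼) {β : ℝ} (hβ : 0 < β) (c s : ℝ) :
    Continuous (barrier Z β c s) := by
  have : Continuous fun x : 𝔼 => infDist x Z ^ β :=
    (continuous_infDist_pt Z).rpow_const fun _ => Or.inr hβ.le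
  unfold barrier
  fun_prop

/-- The set `Z` is removed because `t^β` need not be Lipschitz at `0` when `β < 1`. -/
theorem locallyLipschitzOn_barrier {Z : Set 𝔼} (hZ : IsClosed Z) (hZn : Z.Nonempty) (β c s : ℝ) :
    LocallyLipschitzOn Zᶜ (barrier Z β c s) := by
  have h1 : LocallyLipschitzOn Zᶜ fun x : 𝔼 => infDist x Z :=
    fun x _ => ⟨1, univ, univ_mem, (lipschitz_infDist_pt Z).lipschitzOnWith⟩
  have h2 : LocallyLipschitzOn (Ioi (0 : ℝ)) fun t : ℝ => c * (s ^ β - t ^ β) := by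
    refine ContDiffOn.locallyLipschitzOn_of_isOpen (fun t ht => ?_) isOpen_Ioi
    exact (contDiffAt_const.mul (contDiffAt_const.sub
      (Real.contDiffAt_rpow_const_of_ne (mem_Ioi.1 ht).ne'))).contDiffWithinAt
  have h3 : LocallyLipschitzOn (univ : Set ℝ) fun t : ℝ => max 0 t := fun t _ =>
    ⟨1, univ, univ_mem, (LipschitzWith.id.const_max 0).lipschitzOnWith⟩
  have h4 := locallyLipschitzOn_comp h2 h1 fun x hx => (hZ.notMem_iff_infDist_pos hZn).1 hx
  exact locallyLipschitzOn_comp h3 h4 (mapsTo_univ _ _)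

theorem barrier_eq_zero {Z : Set 𝔼} {β c s : ℝ} (hβ : 0 < β) (hc : 0 < c) (hs : 0 < s) {x : 𝔼}
    (hx : s ≤ infDist x Z) : barrier Z β c s x = 0 := by
  refine max_eq_left (mul_nonpos_of_nonneg_of_nonpos hc.le (sub_nonpos.2 ?_))
  exact Real.rpow_le_rpow hs.le hx hβ.le

theorem barrier_eq {Z : Set 𝔼} {β c s : ℝ} (hβ : 0 < β) (hc : 0 < c) {x : 𝔼}
    (hx : infDist x Z ≤ s) : barrier Z β c s x = c * (s ^ β - infDist x Z ^ β) :=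
  max_eq_right (mul_nonneg hc.le (sub_nonneg.2 (Real.rpow_le_rpow infDist_nonneg hx hβ.le)))

theorem gradient_barrier_eq_zero {Z : Set 𝔼} {β c s : ℝ} (hβ : 0 < β) (hc : 0 < c) (hs : 0 < s)
    {x : 𝔼} (hx : s < infDist x Z) : ∇ (barrier Z β c s) x = 0 := by
  have : barrier Z β c s =ᶠ[𝓝 x] fun _ => 0 := by
    filter_upwards [(continuous_infDist_pt Z).continuousAt.eventually (Ioi_mem_nhds hx)] with y hy
    exact barrier_eq_zero hβ hc hs (le_of_lt hy)
  simp [gradient, this.fderiv_eq]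

/-- `z₀` is the strictly nearest point to `x` among the points of `Z`. -/
def IsStrictNearest (Z : Finset 𝔼) (x z₀ : 𝔼) : Prop :=
  z₀ ∈ Z ∧ ∀ z ∈ Z, z ≠ z₀ → ‖x - z₀‖ < ‖x - z‖

theorem IsStrictNearest.infDist_eq {Z : Finset 𝔼} {x z₀ : 𝔼} (h : IsStrictNearest Z x z₀) :
    infDist x (Z : Set 𝔼) = ‖x - z₀‖ := by
  refine le_antisymm ((infDist_le_dist_of_mem h.1).trans_eq (dist_eq_norm _ _))
    ((le_infDist ⟨z₀, h.1⟩).2 fun {z} hz => ?_)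
  rw [dist_eq_norm]
  by_cases hzz : z = z₀
  · rw [hzz]
  · exact (h.2 z hz hzz).le

theorem IsStrictNearest.eventually {Z : Finset 𝔼} {x z₀ : 𝔼} (h : IsStrictNearest Z x z₀) :
    ∀ᶠ y in 𝓝 x, IsStrictNearest Z y z₀ := by
  have : ∀ᶠ y in 𝓝 x, ∀ z ∈ Z, z ≠ z₀ → ‖y - z₀‖ < ‖y - z‖ := by
    rw [Filter.eventually_all_finset]
    intro z hz
    by_cases hzz : z = z₀
    · simp [hzz]
    · filter_upwards [ContinuousAt.eventually_lt (f := fun y => ‖y - z₀‖) (g := fun y => ‖y - z‖)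
        (by fun_prop) (by fun_prop) (h.2 z hz hzz)] with y hy _ using hy
  exact this.mono fun y hy => ⟨h.1, hy⟩

/-- Being strictly nearest is an open condition, so near `x` the barrier coincides with the radial
profile about `z₀`. -/
theorem gradient_barrier {Z : Finset 𝔼} {β c s : ℝ} (hβ : 0 < β) (hc : 0 < c) {x z₀ : 𝔼}
    (h : IsStrictNearest Z x z₀) (hx : x ≠ z₀) (hs : ‖x - z₀‖ < s) :
    ∇ (barrier (Z : Set 𝔼) β c s) x = -((c * β * ‖x - z₀‖ ^ (β - 2)) • (x - z₀)) := by
  have ht : 0 < ‖x - z₀‖ := norm_pos_iff.2 (sub_ne_zero.2 hx)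
  have heq : barrier (Z : Set 𝔼) β c s =ᶠ[𝓝 x]
      fun y => c * (s ^ β - (‖y - z₀‖ ^ 2) ^ (β / 2)) := by
    filter_upwards [h.eventually, ContinuousAt.eventually_lt (f := fun y => ‖y - z₀‖)
      (g := fun _ => s) (by fun_prop) (by fun_prop) hs, eventually_ne_nhds hx] with y hy hys hyz
    rw [barrier_eq hβ hc (by rw [hy.infDist_eq]; exact hys.le), hy.infDist_eq,
      sq_rpow_half (norm_pos_iff.2 (sub_ne_zero.2 hyz))]
  have hq : ‖x - z₀‖ ^ 2 ≠ 0 := by positivity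
  have hd : HasFDerivAt (fun y => c * (s ^ β - (‖y - z₀‖ ^ 2) ^ (β / 2)))
      (c • -((β / 2 * (‖x - z₀‖ ^ 2) ^ (β / 2 - 1)) • (2 : ℝ) • innerSL ℝ (x - z₀))) x :=
    (((Real.hasDerivAt_rpow_const (Or.inl hq)).comp_hasFDerivAt x
      (hasFDerivAt_norm_sub_sq z₀ x)).const_sub _).const_mul c
  refine ext_inner_right ℝ fun y => ?_
  rw [inner_gradient_eq_fderiv, heq.fderiv_eq, hd.fderiv, inner_neg_left, real_inner_smul_left,
    show β / 2 - 1 = (β - 2) / 2 by ring, sq_rpow_half ht]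
  simp only [smul_apply, neg_apply, smul_eq_mul, innerSL_apply_apply]
  ring

/-- Almost every point has a strictly nearest point in a finite set, at a distance `≠ s`. -/
theorem ae_exists_isStrictNearest {Z : Finset 𝔼} (hZ : Z.Nonempty) {s : ℝ} (hs : 0 < s) :
    ∀ᵐ x : 𝔼, ∃ z₀, IsStrictNearest Z x z₀ ∧ ‖x - z₀‖ ≠ s := by
  have h1 : ∀ᵐ x : 𝔼, ∀ z ∈ Z, ∀ z' ∈ Z, z ≠ z' → ‖x - z‖ ≠ ‖x - z'‖ := by
    refine (ae_ball_iff Z.countable_toSet).2 fun z _ => (ae_ball_iff Z.countable_toSet).2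
      fun z' _ => ?_
    by_cases hzz : z = z'
    · exact Eventually.of_forall fun x h => (h hzz).elim
    -- Ties between two labels occur only on their perpendicular bisector, a proper affine subspace
    -- and so a null set.
    have h0 := Measure.addHaar_affineSubspace volume (AffineSubspace.perpBisector z z')
      (fun h => hzz (AffineSubspace.perpBisector_eq_top.1 h))
    filter_upwards [compl_mem_ae_iff.2 h0] with x hx _ he
    refine hx ?_
    rw [SetLike.mem_coe, AffineSubspace.mem_perpBisector_iff_dist_eq, dist_eq_norm, dist_eq_norm,
      he]
  have h2 : ∀ᵐ x : 𝔼, ∀ z ∈ Z, ‖x - z‖ ≠ s := by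
    refine (ae_ball_iff Z.countable_toSet).2 fun z _ => ?_
    filter_upwards [compl_mem_ae_iff.2 (Measure.addHaar_sphere_of_ne_zero volume z hs.ne')]
      with x hx he
    exact hx (by rwa [mem_sphere, dist_eq_norm])
  filter_upwards [h1, h2] with x hx1 hx2
  obtain ⟨z₀, hz₀, hmin⟩ := Z.exists_min_image (fun z => ‖x - z‖) hZ
  exact ⟨z₀, ⟨hz₀, fun z hz hne => lt_of_le_of_ne (hmin z hz) (hx1 z₀ hz₀ z hz hne.symm)⟩,
    hx2 z₀ hz₀⟩

open Classical in
/-- The limits of the softmin weights. -/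
def nearWeight (Z : Finset 𝔼) (s : ℝ) (z x : 𝔼) : ℝ :=
  if IsStrictNearest Z x z ∧ ‖x - z‖ < s then 1 else 0

theorem nearWeight_of_lt [DecidableEq 𝔼] {Z : Finset 𝔼} {s : ℝ} {x z₀ : 𝔼}
    (h : IsStrictNearest Z x z₀) (hs : ‖x - z₀‖ < s) (z : 𝔼) :
    nearWeight Z s z x = if z = z₀ then 1 else 0 := by
  unfold nearWeight
  by_cases hz : z = z₀
  · subst hz; simp [h, hs]
  · rw [if_neg, if_neg hz]
    rintro ⟨hz', -⟩
    exact lt_asymm (h.2 z hz'.1 hz) (hz'.2 z₀ h.1 (Ne.symm hz))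

theorem nearWeight_of_gt {Z : Finset 𝔼} {s : ℝ} {x z₀ : 𝔼}
    (h : IsStrictNearest Z x z₀) (hs : s < ‖x - z₀‖) (z : 𝔼) : nearWeight Z s z x = 0 := by
  unfold nearWeight
  refine if_neg ?_
  rintro ⟨hz', hlt⟩
  have := hz'.infDist_eq.symm.trans h.infDist_eq
  linarith

theorem norm_nearWeight_le (Z : Finset 𝔼) (s : ℝ) (z x : 𝔼) : ‖nearWeight Z s z x‖ ≤ 1 := by
  unfold nearWeight
  split_ifs <;> simp

/-- As `N` is strictly increasing with `N(s²) = 0`, the values `N(|x - j|²)` have a unique negative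
minimum if the nearest label is closer than `s`, and are all positive if it is farther. In the
second case the value `0` takes all the mass. -/
theorem tendsto_softWeight_nearWeight {Z : Finset 𝔼} {s : ℝ} (hs : 0 < s) {N : ℝ → ℝ}
    (hN : StrictMonoOn N (Ioi 0)) (hNs : N (s ^ 2) = 0) {x z₀ : 𝔼} (hxZ : x ∉ Z)
    (h : IsStrictNearest Z x z₀) (hne : ‖x - z₀‖ ≠ s) {z : 𝔼} (hz : z ∈ Z) :
    Tendsto (fun n : ℕ => softWeight Z n (fun j => N (‖x - j‖ ^ 2)) z) atTop
      (𝓝 (nearWeight Z s z x)) := by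
  classical
  have hpos : ∀ z ∈ Z, 0 < ‖x - z‖ := fun z hz =>
    norm_pos_iff.2 (sub_ne_zero.2 fun h => hxZ (h ▸ hz))
  have hlt : ∀ {a b : ℝ}, 0 < a → 0 < b → a < b → N (a ^ 2) < N (b ^ 2) := fun ha hb hab =>
    hN (sq_pos_of_pos ha) (sq_pos_of_pos hb) (pow_lt_pow_left₀ hab ha.le two_ne_zero)
  rcases hne.lt_or_gt with hlt' | hgt
  · rw [nearWeight_of_lt h hlt']
    refine tendsto_softWeight_of_min h.1 ?_ (fun j hj hjne => ?_) hz
    · exact (hlt (hpos _ h.1) hs hlt').trans_eq hNs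
    · exact hlt (hpos _ h.1) (hpos _ hj) (h.2 j hj hjne)
  · rw [nearWeight_of_gt h hgt]
    refine tendsto_softWeight_of_pos ?_
    have : s < ‖x - z‖ := by
      by_cases hzz : z = z₀
      · rwa [hzz]
      · exact hgt.trans (h.2 z hz hzz)
    exact hNs.symm.trans_lt (hlt hs (hpos z hz) this)

/-- Measurability is inherited from the softmin weights, which are continuous on `U` and converge
almost everywhere. -/
theorem aestronglyMeasurable_nearWeight {Z : Finset 𝔼} (hZ : Z.Nonempty) {s : ℝ} (hs : 0 < s)
    {U : Set 𝔼} (hU : IsOpen U) (hZU : ∀ z ∈ Z, z ∉ U) {N : ℝ → ℝ} (hN : ContDiffOn ℝ 1 N (Ioi 0))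
    (hNm : StrictMonoOn N (Ioi 0)) (hNs : N (s ^ 2) = 0) {z : 𝔼} (hz : z ∈ Z) :
    AEStronglyMeasurable (nearWeight Z s z) (volume.restrict U) := by
  refine aestronglyMeasurable_of_tendsto_ae atTop
    (fun n : ℕ => (contDiffOn_softWeight hZU hN n hz).continuousOn.aestronglyMeasurable
      hU.measurableSet) ?_
  refine (ae_restrict_iff' hU.measurableSet).2 ?_
  filter_upwards [ae_exists_isStrictNearest hZ hs] with x ⟨z₀, h, hne⟩ hxU
  exact tendsto_softWeight_nearWeight hs hNm hNs (fun hx => hZU x hx hxU) h hne hz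

end BarrierGeometry

/-! ### The barrier as a weak subsolution -/

section Subsolution

/-- Equality holds where `ρ` is differentiable; elsewhere `∇ ρ` has the default value `0`. -/
theorem norm_gradient_le_mul_norm_gradient_log {ρ : 𝔼 → ℝ} {x : 𝔼} (hx : 0 < ρ x) :
    ‖∇ ρ x‖ ≤ ρ x * ‖∇ (fun y => Real.log (ρ y)) x‖ := by
  by_cases hd : DifferentiableAt ℝ ρ x
  · have h := hd.hasFDerivAt.log hx.ne'
    rw [gradient, gradient, LinearIsometryEquiv.norm_map, LinearIsometryEquiv.norm_map, h.fderiv,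
      norm_smul, norm_inv, Real.norm_of_nonneg hx.le, mul_inv_cancel_left₀ hx.ne']
  · rw [gradient_eq_zero_of_not_differentiableAt hd, norm_zero]
    positivity

theorem weight_mul_rpow {α β t : ℝ} (ht : 0 < t) :
    (1 + t ^ (-α)) * t ^ (β - 2) = t ^ (β - 2 - α) * (1 + t ^ α) := by
  rw [add_mul, mul_add, ← Real.rpow_add ht, ← Real.rpow_add ht, one_mul, mul_one,
    show -α + (β - 2) = β - 2 - α by ring, show β - 2 - α + α = β - 2 by ring, add_comm]

variable {U L : Set (EuclideanSpace ℝ (Fin d))} {Z : Finset (EuclideanSpace ℝ (Fin d))}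
  {ρ η v : EuclideanSpace ℝ (Fin d) → ℝ}
  {h : EuclideanSpace ℝ (Fin d) → EuclideanSpace ℝ (Fin d)} {α β τ R s Λ : ℝ}

/-- Within distance `s` only the nearest label contributes, and where `v ≠ 0` the cutoff is
invisible, so the radial inequality applies; its right side has `R^β` where the barrier has the
smaller `s^β`. Beyond distance `s` both sides vanish. -/
theorem sum_nearWeight_fluxDiv_le (hβ : 2 * β = α + 2 - d) (hβ0 : 0 < β) (hα : -1 < α)
    (hΛ : 0 ≤ Λ) (hτ : 0 ≤ τ) (hs : 0 < s) (hsR : s < R) (hR1 : R ≤ 1)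
    (hbound : 2 * Λ * R * (1 + R ^ α) + α * R ^ α ≤ β / 2) {x z₀ : 𝔼}
    (hz₀ : IsStrictNearest Z x z₀) (hne : ‖x - z₀‖ ≠ s) (hx : x ≠ z₀) (hρx : 0 < ρ x)
    (hgrad : ‖x - z₀‖ < s → ‖∇ ρ x‖ ≤ ρ x * Λ)
    (hτR : ‖x - z₀‖ < s → τ * R ^ (d : ℝ) ≤ 4 / 9 * β ^ 2 * ρ x) (hv0 : 0 ≤ v x)
    (hη : v x ≠ 0 → ‖x - z₀‖ < s → η x = 1 ∧ ∇ η x = 0) :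
    ∑ z ∈ Z, nearWeight Z s z x * (v x * fluxDiv ρ η (fluxCoeff α β (R ^ (-β))) z x)
      ≤ -(τ * (ρ x * barrier (Z : Set 𝔼) β (R ^ (-β)) s x * v x)) := by
  classical
  have hR : 0 < R := hs.trans hsR
  have hc : 0 < R ^ (-β) := Real.rpow_pos_of_pos hR _
  have ht : 0 < ‖x - z₀‖ := norm_pos_iff.2 (sub_ne_zero.2 hx)
  rcases hne.lt_or_gt with hlt | hgt
  · simp only [nearWeight_of_lt hz₀ hlt, ite_mul, one_mul, zero_mul, Finset.sum_ite_eq', hz₀.1,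
      if_true]
    by_cases hvx : v x = 0
    · simp [hvx]
    obtain ⟨hη1, hη2⟩ := hη hvx hlt
    have hI : inner ℝ (∇ ρ x) (x - z₀) ≤ ρ x * Λ * ‖x - z₀‖ :=
      (real_inner_le_norm _ _).trans (by gcongr; exact hgrad hlt)
    have hf := flux_inequality hβ hβ0 hα (Nat.cast_nonneg d) hΛ hτ hρx ht (hlt.trans hsR).le hR1
      hbound hI (hτR hlt)
    have hfd : fluxDiv ρ η (fluxCoeff α β (R ^ (-β))) z₀ x
        ≤ -(τ * ρ x * (R ^ (-β) * (R ^ β - ‖x - z₀‖ ^ β))) := by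
      refine le_trans (le_of_eq ?_) hf
      simp only [fluxDiv, hη1, hη2, inner_zero_left]
      ring
    have hB : barrier (Z : Set 𝔼) β (R ^ (-β)) s x ≤ R ^ (-β) * (R ^ β - ‖x - z₀‖ ^ β) := by
      rw [barrier_eq hβ0 hc (by rw [hz₀.infDist_eq]; exact hlt.le), hz₀.infDist_eq]
      gcongr
    have hB' : τ * ρ x * barrier (Z : Set 𝔼) β (R ^ (-β)) s x
        ≤ τ * ρ x * (R ^ (-β) * (R ^ β - ‖x - z₀‖ ^ β)) := by gcongr
    nlinarith [mul_le_mul_of_nonneg_left (hfd.trans (neg_le_neg hB')) hv0]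
  · simp only [nearWeight_of_gt hz₀ hgt, zero_mul, Finset.sum_const_zero]
    rw [barrier_eq_zero hβ0 hc hs (by rw [hz₀.infDist_eq]; exact hgt.le)]
    simp

/-- The limit of the softmin fluxes is `-γ ρ² ∇ B` wherever it is tested: the nearest point of `Z`
is also nearest in `L`, so `γ = 1 + |x - z₀|^(-α)` is the weight built into `fluxCoeff`. -/
theorem sum_nearWeight_flux_eq (hβ0 : 0 < β) (hs : 0 < s) (hR : 0 < R) {x z₀ : 𝔼}
    (hz₀ : IsStrictNearest Z x z₀) (hne : ‖x - z₀‖ ≠ s) (hx : x ≠ z₀)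
    (hL : ‖x - z₀‖ < s → infDist x L = ‖x - z₀‖)
    (hη : h x ≠ 0 → ‖x - z₀‖ < s → η x = 1) :
    ∑ z ∈ Z, nearWeight Z s z x * (η x * ρ x ^ 2 * fluxCoeff α β (R ^ (-β)) (‖x - z‖ ^ 2)
        * inner ℝ (x - z) (h x))
      = -(weight α L x * ρ x ^ 2 *
        inner ℝ (∇ (barrier (Z : Set 𝔼) β (R ^ (-β)) s) x) (h x)) := by
  classical
  have hc : 0 < R ^ (-β) := Real.rpow_pos_of_pos hR _
  have ht : 0 < ‖x - z₀‖ := norm_pos_iff.2 (sub_ne_zero.2 hx)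
  rcases hne.lt_or_gt with hlt | hgt
  · simp only [nearWeight_of_lt hz₀ hlt, ite_mul, one_mul, zero_mul, Finset.sum_ite_eq', hz₀.1,
      if_true]
    by_cases hhx : h x = 0
    · simp [hhx]
    rw [hη hhx hlt, gradient_barrier hβ0 hc hz₀ hx hlt, weight, hL hlt, inner_neg_left,
      real_inner_smul_left, fluxCoeff_sq ht]
    have := weight_mul_rpow (α := α) (β := β) ht
    linear_combination (-(ρ x ^ 2 * R ^ (-β) * β * inner ℝ (x - z₀) (h x))) * this
  · simp only [nearWeight_of_gt hz₀ hgt, zero_mul, Finset.sum_const_zero]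
    rw [gradient_barrier_eq_zero hβ0 hc hs (by rwa [hz₀.infDist_eq])]
    simp

/-- The barrier is a weak subsolution. -/
theorem barrier_subsolution (hU : IsOpen U) (hZn : Z.Nonempty) (hZU : ∀ z ∈ Z, z ∉ U)
    (hρ : LocallyLipschitzOn U ρ) (hρ0 : ∀ x ∈ U, 0 < ρ x)
    (hη : ContDiff ℝ ∞ η) (hηc : HasCompactSupport η) (hηU : tsupport η ⊆ U) (hη0 : ∀ x, 0 ≤ η x)
    (hv : ContinuousOn v U) (hv0 : ∀ x, 0 ≤ v x) (hvh : HasWeakGradientOn v h U)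
    (hβ : 2 * β = α + 2 - d) (hβ0 : 0 < β) (hα : -1 < α)
    (hΛ : 0 ≤ Λ) (hτ : 0 ≤ τ) (hs : 0 < s) (hsR : s < R) (hR1 : R ≤ 1)
    (hbound : 2 * Λ * R * (1 + R ^ α) + α * R ^ α ≤ β / 2)
    (hL : ∀ x, infDist x (Z : Set 𝔼) < s → infDist x L = infDist x (Z : Set 𝔼))
    (hgrad : ∀ᵐ x ∂volume.restrict U, infDist x (Z : Set 𝔼) < s → ‖∇ ρ x‖ ≤ ρ x * Λ)
    (hτR : ∀ x, infDist x (Z : Set 𝔼) < s → τ * R ^ (d : ℝ) ≤ 4 / 9 * β ^ 2 * ρ x)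
    (hvη : ∀ x ∈ U, v x ≠ 0 → infDist x (Z : Set 𝔼) < s → η x = 1 ∧ ∇ η x = 0)
    (hhη : ∀ x ∈ U, h x ≠ 0 → infDist x (Z : Set 𝔼) < s → η x = 1)
    (hInt : IntegrableOn (fun x => ρ x * barrier (Z : Set 𝔼) β (R ^ (-β)) s x * v x) U) :
    IntegrableOn (fun x => weight α L x * ρ x ^ 2 *
        inner ℝ (∇ (barrier (Z : Set 𝔼) β (R ^ (-β)) s) x) (h x)) U ∧
      τ * (∫ x in U, ρ x * barrier (Z : Set 𝔼) β (R ^ (-β)) s x * v x)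
        ≤ -∫ x in U, weight α L x * ρ x ^ 2 *
          inner ℝ (∇ (barrier (Z : Set 𝔼) β (R ^ (-β)) s) x) (h x) := by
  have hR : 0 < R := hs.trans hsR
  have hc : 0 < R ^ (-β) := Real.rpow_pos_of_pos hR _
  have hm := contDiffOn_fluxCoeff α β (R ^ (-β))
  -- Normalizing `N` at `s²` makes the softmin switch to the value `0` exactly where the barrier is
  -- truncated.
  obtain ⟨N, hN, hN', hNm, hNs⟩ := exists_primitive hm.continuousOn
    (fun q hq => fluxCoeff_pos hβ0 hc hq) (sq_pos_of_pos hs)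
  have hgen : ∀ᵐ x ∂volume.restrict U, x ∈ U ∧ ∃ z₀, IsStrictNearest Z x z₀ ∧ ‖x - z₀‖ ≠ s :=
    (ae_restrict_mem hU.measurableSet).and (ae_restrict_of_ae (ae_exists_isStrictNearest hZn hs))
  have hW : ∀ᵐ x ∂volume.restrict U, ∀ z ∈ Z,
      Tendsto (fun n : ℕ => softWeight Z n (fun j => N (‖x - j‖ ^ 2)) z) atTop
        (𝓝 (nearWeight Z s z x)) := by
    filter_upwards [hgen] with x ⟨hxU, z₀, hz₀, hne⟩ z hz
    exact tendsto_softWeight_nearWeight hs hNm hNs (fun hx => hZU x hx hxU) hz₀ hne hz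
  have hWint : ∀ {F : 𝔼 → 𝔼 → ℝ}, (∀ z ∈ Z, IntegrableOn (F z) U) →
      IntegrableOn (fun x => ∑ z ∈ Z, nearWeight Z s z x * F z x) U := fun hF =>
    integrable_finsetSum _ fun z hz => (hF z hz).bdd_mul
      (aestronglyMeasurable_nearWeight hZn hs hU hZU hN hNm hNs hz)
      (Eventually.of_forall (norm_nearWeight_le Z s z))
  have hmain := integral_limit_flux_ge hU hZU hρ hη hηc hηU hη0 hv hv0 hvh hN hN' hm hW
  have hle : ∀ᵐ x ∂volume.restrict U,
      ∑ z ∈ Z, nearWeight Z s z x * (v x * fluxDiv ρ η (fluxCoeff α β (R ^ (-β))) z x)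
        ≤ -(τ * (ρ x * barrier (Z : Set 𝔼) β (R ^ (-β)) s x * v x)) := by
    filter_upwards [hgen, hgrad] with x ⟨hxU, z₀, hz₀, hne⟩ hgx
    have he := hz₀.infDist_eq
    refine sum_nearWeight_fluxDiv_le hβ hβ0 hα hΛ hτ hs hsR hR1 hbound hz₀ hne
      (fun hx => hZU z₀ hz₀.1 (hx ▸ hxU)) (hρ0 x hxU) (fun hlt => hgx (by rwa [he]))
      (fun hlt => hτR x (by rwa [he])) (hv0 x) fun hvx hlt => hvη x hxU hvx (by rwa [he])
  have heq : ∀ᵐ x ∂volume.restrict U,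
      ∑ z ∈ Z, nearWeight Z s z x * (η x * ρ x ^ 2 * fluxCoeff α β (R ^ (-β)) (‖x - z‖ ^ 2)
        * inner ℝ (x - z) (h x))
      = -(weight α L x * ρ x ^ 2 *
        inner ℝ (∇ (barrier (Z : Set 𝔼) β (R ^ (-β)) s) x) (h x)) := by
    filter_upwards [hgen] with x ⟨hxU, z₀, hz₀, hne⟩
    have he := hz₀.infDist_eq
    exact sum_nearWeight_flux_eq hβ0 hs hR hz₀ hne (fun hx => hZU z₀ hz₀.1 (hx ▸ hxU))
      (fun hlt => (hL x (by rwa [he])).trans he) fun hhx hlt => hhη x hxU hhx (by rwa [he])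
  have hInt1 := hWint fun z hz => integrableOn_flux hU hZU hρ hη hηc hηU hvh hm hz
  have hInt2 := hWint fun z hz => integrableOn_mul_fluxDiv hU hZU hρ hη hηc hηU hv hm hz
  refine ⟨?_, ?_⟩
  · exact (hInt1.congr heq).neg.congr (Eventually.of_forall fun x => neg_neg _)
  · rw [integral_congr_ae heq, integral_neg] at hmain
    have h1 := integral_mono_ae hInt2 (hInt.const_mul τ).neg hle
    have h2 : ∫ x in U, -(τ * (ρ x * barrier (Z : Set 𝔼) β (R ^ (-β)) s x * v x))
        = -(τ * ∫ x in U, ρ x * barrier (Z : Set 𝔼) β (R ^ (-β)) s x * v x) := by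
      rw [integral_neg, integral_const_mul]
    simp only [Pi.neg_apply] at h1
    linarith

end Subsolution

/-! ### Comparison with the barrier -/

section Comparison

/-- Vanishing up to `ε > 0` makes `G(B - u)` zero near the labels; the bounds on `G` and `G'` keep
its energy finite, `C¹` regularity serves the chain rule, and positivity above `ε` makes the
conclusion `G(B - u) = 0` informative. -/
theorem exists_smooth_truncation (ε : ℝ) :
    ∃ (G : ℝ → ℝ) (M : ℝ), ContDiff ℝ 1 G ∧ (∀ t, 0 ≤ G t) ∧ (∀ t, G t ≤ 1) ∧
      (∀ t ≤ ε, G t = 0) ∧ (∀ t > ε, 0 < G t) ∧ (∀ t, 0 ≤ deriv G t) ∧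
      (∀ t < ε, deriv G t = 0) ∧ ∀ t, deriv G t ≤ M := by
  set G : ℝ → ℝ := fun t => Real.smoothTransition (t - ε) with hG
  have hGc : ContDiff ℝ 1 G :=
    (Real.smoothTransition.contDiff (n := 1)).comp (contDiff_id.sub contDiff_const)
  have hmono : Monotone G := fun a b hab => Real.smoothTransition.monotone (by linarith)
  have h0 : ∀ t < ε, deriv G t = 0 := fun t ht => by
    have : G =ᶠ[𝓝 t] fun _ => 0 := by
      filter_upwards [Iio_mem_nhds ht] with y hy
      exact Real.smoothTransition.zero_of_nonpos (by linarith [mem_Iio.1 hy])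
    rw [this.deriv_eq, deriv_const]
  have h1 : ∀ t > ε + 1, deriv G t = 0 := fun t ht => by
    have : G =ᶠ[𝓝 t] fun _ => 1 := by
      filter_upwards [Ioi_mem_nhds ht] with y hy
      exact Real.smoothTransition.one_of_one_le (by linarith [mem_Ioi.1 hy])
    rw [this.deriv_eq, deriv_const]
  obtain ⟨M, hM⟩ := (isCompact_Icc (a := ε) (b := ε + 1)).exists_bound_of_continuousOn
    (hGc.continuous_deriv le_rfl).continuousOn
  have hM0 : 0 ≤ M := (norm_nonneg _).trans (hM ε (by simp))
  refine ⟨G, M, hGc, fun t => Real.smoothTransition.nonneg _,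
    fun t => Real.smoothTransition.le_one _,
    fun t ht => Real.smoothTransition.zero_of_nonpos (by linarith),
    fun t ht => Real.smoothTransition.pos_of_pos (by linarith), fun t => hmono.deriv_nonneg, h0,
    fun t => ?_⟩
  by_cases ht : t ∈ Icc ε (ε + 1)
  · exact (le_abs_self _).trans (hM t ht)
  · rw [mem_Icc, not_and_or, not_le, not_le] at ht
    rcases ht with ht | ht
    · rwa [h0 t ht]
    · rwa [h1 t ht]

theorem continuousOn_weight {L : Set 𝔼} (hL : IsClosed L) (hLn : L.Nonempty) (α : ℝ) :
    ContinuousOn (weight α L) Lᶜ :=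
  continuousOn_const.add ((continuous_infDist_pt L).continuousOn.rpow_const fun _ hx =>
    Or.inl ((hL.notMem_iff_infDist_pos hLn).1 hx).ne')

theorem one_le_weight (α : ℝ) (L : Set 𝔼) (x : 𝔼) : 1 ≤ weight α L x :=
  le_add_of_nonneg_right (Real.rpow_nonneg infDist_nonneg _)

theorem isCompact_setOf_infDist_le {Z : Finset 𝔼} (hZ : Z.Nonempty) (s : ℝ) :
    IsCompact {x : 𝔼 | infDist x (Z : Set 𝔼) ≤ s} := by
  refine Metric.isCompact_of_isClosed_isBounded
    (isClosed_le (continuous_infDist_pt _) continuous_const) ?_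
  obtain ⟨M, hM⟩ := (isBounded_iff_subset_closedBall (0 : 𝔼)).1 Z.finite_toSet.isBounded
  refine (isBounded_closedBall (x := (0 : 𝔼)) (r := s + M)).subset fun x hx => ?_
  obtain ⟨z, hz, hxz⟩ := Z.finite_toSet.isCompact.exists_infDist_eq_dist (by exact_mod_cast hZ) x
  have h1 := hM hz
  rw [mem_closedBall] at h1 ⊢
  rw [mem_ofPred_eq, hxz] at hx
  linarith [dist_triangle x z 0]

/-- A function on a preconnected set that is locally constant there is constant. -/
theorem eq_of_locally_const {X : Type*} [TopologicalSpace X] {f : X → ℝ} {s : Set X}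
    (hs : IsPreconnected s) (hf : ∀ x ∈ s, ∀ᶠ y in 𝓝 x, f y = f x) {x y : X} (hx : x ∈ s)
    (hy : y ∈ s) : f x = f y := by
  refine hs.induction₂ (fun x y => f x = f y) (fun x hx => ?_) (fun x y z _ _ _ => Eq.trans)
    (fun x y _ _ => Eq.symm) hx hy
  exact nhdsWithin_le_nhds ((hf x hx).mono fun y hy => hy.symm)

variable {Ω L : Set (EuclideanSpace ℝ (Fin d))} {Z : Finset (EuclideanSpace ℝ (Fin d))}
  {ρ u v : EuclideanSpace ℝ (Fin d) → ℝ}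
  {g h : EuclideanSpace ℝ (Fin d) → EuclideanSpace ℝ (Fin d)} {α β τ R s Λ ε : ℝ}

theorem integrableOn_mul_of_sq {U : Set 𝔼} {a b : 𝔼 → ℝ} (hU : MeasurableSet U)
    (hρ0 : ∀ x ∈ U, 0 ≤ ρ x)
    (hm : AEStronglyMeasurable (fun x => ρ x * a x * b x) (volume.restrict U))
    (ha : IntegrableOn (fun x => ρ x * a x ^ 2) U) (hb : IntegrableOn (fun x => ρ x * b x ^ 2) U) :
    IntegrableOn (fun x => ρ x * a x * b x) U := by
  refine Integrable.mono' (ha.add hb) hm (ae_restrict_of_forall_mem hU fun x hx => ?_)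
  have h0 := hρ0 x hx
  simp only [Pi.add_apply]
  rw [norm_mul, norm_mul, Real.norm_of_nonneg h0, Real.norm_eq_abs, Real.norm_eq_abs]
  have : |a x| * |b x| ≤ a x ^ 2 + b x ^ 2 := by
    rw [← sq_abs (a x), ← sq_abs (b x)]
    nlinarith [sq_nonneg (|a x| - |b x|), sq_nonneg |a x|, sq_nonneg |b x|]
  nlinarith [mul_le_mul_of_nonneg_left this h0]

theorem integrableOn_inner_of_norm_sq {U : Set 𝔼} {κ : 𝔼 → ℝ} (hU : MeasurableSet U)
    (hκ0 : ∀ x ∈ U, 0 ≤ κ x)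
    (hm : AEStronglyMeasurable (fun x => κ x * inner ℝ (g x) (h x)) (volume.restrict U))
    (ha : IntegrableOn (fun x => κ x * ‖g x‖ ^ 2) U)
    (hb : IntegrableOn (fun x => κ x * ‖h x‖ ^ 2) U) :
    IntegrableOn (fun x => κ x * inner ℝ (g x) (h x)) U := by
  refine Integrable.mono' (ha.add hb) hm (ae_restrict_of_forall_mem hU fun x hx => ?_)
  have h0 := hκ0 x hx
  simp only [Pi.add_apply]
  rw [norm_mul, Real.norm_of_nonneg h0]
  have : ‖(inner ℝ (g x) (h x) : ℝ)‖ ≤ ‖g x‖ ^ 2 + ‖h x‖ ^ 2 :=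
    (norm_inner_le_norm _ _).trans
      (by nlinarith [sq_nonneg (‖g x‖ - ‖h x‖), sq_nonneg ‖g x‖, sq_nonneg ‖h x‖])
  nlinarith [mul_le_mul_of_nonneg_left this h0]

theorem integrableOn_weight_norm_gradient_sq {U K : Set 𝔼} {f a : 𝔼 → ℝ} (hU : IsOpen U)
    (hK : IsCompact K) (hKU : K ⊆ U) (hf : LocallyLipschitzOn U f) (ha : ContinuousOn a K) :
    IntegrableOn (fun x => a x * ‖∇ f x‖ ^ 2) K := by
  obtain ⟨C, hC⟩ := exists_gradient_bound hK hU hKU hf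
  have h : IntegrableOn (fun x => ‖∇ f x‖ ^ 2) K := by
    refine Integrable.mono' (integrableOn_const hK.measure_lt_top.ne (C := C ^ 2))
      ((measurable_gradient f).norm.pow_const 2).aestronglyMeasurable
      (ae_restrict_of_forall_mem hK.measurableSet fun x hx => ?_)
    rw [norm_pow, norm_norm]
    exact pow_le_pow_left₀ (norm_nonneg _) (hC x hx) 2
  exact h.continuousOn_mul ha hK

end Comparison

/-! ### Comparison argument and lower bound for a solution -/

section SolutionBound

variable {Ω L : Set (EuclideanSpace ℝ (Fin d))} {Z : Finset (EuclideanSpace ℝ (Fin d))}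
  {ρ u : EuclideanSpace ℝ (Fin d) → ℝ} {α β τ R s Λ ε : ℝ}

/-- The test function is `G(B - u)`. Its zeroth-order contribution has a sign because `B - u` and
`G(B - u)` are never of opposite signs, so monotonicity of `G` forces the gradient contribution to
vanish. -/
theorem barrier_le_solution_add (hΩ : IsOpen Ω) (hLf : L.Finite) (hLΩ : L ⊆ Ω) (hZn : Z.Nonempty)
    (hZL : (Z : Set 𝔼) ⊆ L) (hρ0 : ∀ x ∈ Ω, 0 < ρ x) (hρ : LocallyLipschitzOn Ω ρ)
    (hβ : 2 * β = α + 2 - d) (hβ0 : 0 < β) (hα : -1 < α)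
    (hΛ : 0 ≤ Λ) (hτ : 0 ≤ τ) (hs : 0 < s) (hsR : s < R) (hR1 : R ≤ 1) (hε : 0 < ε)
    (hbound : 2 * Λ * R * (1 + R ^ α) + α * R ^ α ≤ β / 2)
    (hRΩ : ∀ x, infDist x (Z : Set 𝔼) < R → x ∈ Ω)
    (hL : ∀ x, infDist x (Z : Set 𝔼) < R → infDist x L = infDist x (Z : Set 𝔼))
    (hgrad : ∀ᵐ x, infDist x (Z : Set 𝔼) < R → ‖∇ (fun y => Real.log (ρ y)) x‖ ≤ Λ)
    (hτR : ∀ x, infDist x (Z : Set 𝔼) < R → τ * R ^ (d : ℝ) ≤ 4 / 9 * β ^ 2 * ρ x)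
    (hsol : IsSolution Ω L Z τ α ρ u) {x₀ : 𝔼} (hx₀ : infDist x₀ (Z : Set 𝔼) < R) :
    barrier (Z : Set 𝔼) β (R ^ (-β)) s x₀ ≤ u x₀ + ε := by
  have hR : 0 < R := hs.trans hsR
  have hc : 0 < R ^ (-β) := Real.rpow_pos_of_pos hR _
  obtain ⟨g, hmem, htest⟩ := hsol.weak
  obtain ⟨G, M, hG, hG0, hG1, hGz, hGpos, hG'0, hG'z, hG'M⟩ := exists_smooth_truncation ε
  have hLn : L.Nonempty := (Finset.coe_nonempty.2 hZn).mono hZL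
  have hZc : IsClosed (Z : Set 𝔼) := Z.finite_toSet.isClosed
  have hZn' : (Z : Set 𝔼).Nonempty := Finset.coe_nonempty.2 hZn
  have hLc : IsClosed L := hLf.isClosed
  have hU : IsOpen (Ω \ L) := hΩ.sdiff hLc
  have hUm : MeasurableSet (Ω \ L) := hU.measurableSet
  set U := Ω \ L with hUdef
  have hUΩ : U ⊆ Ω := sdiff_subset
  set B := barrier (Z : Set 𝔼) β (R ^ (-β)) s with hB
  have hBc : Continuous B := continuous_barrier _ hβ0 _ _
  have hBl : LocallyLipschitzOn U B := (locallyLipschitzOn_barrier hZc hZn' β _ s).mono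
    fun x hx hxZ => hx.2 (hZL hxZ)
  set w : 𝔼 → ℝ := fun x => B x - u x with hw
  have hwΩ : ContinuousOn w Ω := hBc.continuousOn.sub hsol.continuousOn
  have hwU : ContinuousOn w U := hwΩ.mono hUΩ
  have hwg : HasWeakGradientOn w (fun x => ∇ B x - g x) U :=
    (hasWeakGradientOn_of_locallyLipschitzOn hU hBl).sub hUm hmem.hasWeakGradient
  set v : 𝔼 → ℝ := fun x => G (w x) with hv
  set h : 𝔼 → 𝔼 := fun x => deriv G (w x) • (∇ B x - g x) with hh
  have hvh : HasWeakGradientOn v h U := hwg.comp_contDiff hU hwU hG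
  have hvΩ : ContinuousOn v Ω := hG.continuous.comp_continuousOn hwΩ
  have hvU : ContinuousOn v U := hvΩ.mono hUΩ
  -- the neighborhood of the labels on which the test function vanishes
  set V : Set 𝔼 := Ω ∩ w ⁻¹' Iio ε with hV
  have hVo : IsOpen V := hwΩ.isOpen_inter_preimage hΩ isOpen_Iio
  -- On `Z` the barrier equals `(s / R)^β ≤ 1 = u`. Any other label is at distance at least `R` from
  -- `Z`, so there `B = 0 = u`.
  have hLV : L ⊆ V := by
    intro z hz
    refine ⟨hLΩ hz, ?_⟩
    simp only [mem_preimage, mem_Iio, hw]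
    by_cases hzZ : z ∈ (Z : Set 𝔼)
    · rw [hsol.eq_one z hzZ, hB, barrier_eq hβ0 hc (by rw [infDist_zero_of_mem hzZ]; exact hs.le),
        infDist_zero_of_mem hzZ, Real.zero_rpow hβ0.ne', sub_zero]
      have : R ^ (-β) * s ^ β ≤ R ^ (-β) * R ^ β := by gcongr
      rw [← Real.rpow_add hR, neg_add_cancel, Real.rpow_zero] at this
      linarith
    · have hzR : R ≤ infDist z (Z : Set 𝔼) := by
        by_contra hlt
        have := hL z (not_le.1 hlt)
        rw [infDist_zero_of_mem hz] at this
        exact hzZ ((hZc.mem_iff_infDist_zero hZn').2 this.symm)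
      rw [hsol.eq_zero z ⟨hz, hzZ⟩, hB, barrier_eq_zero hβ0 hc hs (hsR.le.trans hzR)]
      linarith
  have hvV : ∀ x ∈ V, v x = 0 := fun x hx => hGz _ (le_of_lt hx.2)
  have hhV : ∀ x ∈ V, deriv G (w x) = 0 := fun x hx => hG'z _ hx.2
  -- the cutoff function
  set K : Set 𝔼 := {x | infDist x (Z : Set 𝔼) ≤ s} \ V with hK
  have hKc : IsCompact K := (isCompact_setOf_infDist_le hZn s).diff hVo
  have hKU : K ⊆ U := fun x hx => ⟨hRΩ x (lt_of_le_of_lt hx.1 hsR), fun hxL => hx.2 (hLV hxL)⟩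
  obtain ⟨η, hη, hηc, hηU, hη1, hη01⟩ := exists_smooth_cutoff hKc hU hKU
  have hηK : ∀ x ∈ K, η x = 1 ∧ ∇ η x = 0 := fun x hx => by
    have : η =ᶠ[𝓝 x] fun _ => 1 := hη1.filter_mono (nhds_le_nhdsSet hx)
    refine ⟨this.self_of_nhds, ?_⟩
    simp [gradient, this.fderiv_eq]
  -- measurability and integrability
  have hρU : ContinuousOn ρ U := hρ.continuousOn.mono hUΩ
  have hγU : ContinuousOn (weight α L) U :=
    (continuousOn_weight hLc hLn α).mono fun x hx => hx.2
  have hκU : ContinuousOn (fun x => weight α L x * ρ x ^ 2) U := hγU.mul (hρU.pow 2)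
  have hκm := hκU.aestronglyMeasurable (μ := volume) hUm
  have hκ0 : ∀ x ∈ U, 0 < weight α L x * ρ x ^ 2 := fun x hx =>
    mul_pos (one_pos.trans_le (one_le_weight α L x)) (pow_pos (hρ0 x (hUΩ hx)) 2)
  have hgm : AEStronglyMeasurable g (volume.restrict U) :=
    hmem.hasWeakGradient.locallyIntegrable_grad.aestronglyMeasurable
  have hhm : AEStronglyMeasurable h (volume.restrict U) :=
    hvh.locallyIntegrable_grad.aestronglyMeasurable
  have huU : ContinuousOn u U := hsol.continuousOn.mono hUΩ
  have hBsq : IntegrableOn (fun x => ρ x * B x ^ 2) U := by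
    have hKs := isCompact_setOf_infDist_le hZn s
    refine integrableOn_of_tsupport hUm
      (ContinuousOn.integrableOn_compact hKs ?_) fun x hx => ?_
    · exact (hρ.continuousOn.mono fun x hx => hRΩ x (lt_of_le_of_lt hx hsR)).mul
        (hBc.continuousOn.pow 2)
    · rw [hB, barrier_eq_zero hβ0 hc hs (not_le.1 hx).le]
      simp
  have hvsq : IntegrableOn (fun x => ρ x * v x ^ 2) U := by
    refine Integrable.mono' ((hBsq.add hmem.integrable_sq).const_mul (2 / ε ^ 2))
      ((hρU.mul (hvU.pow 2)).aestronglyMeasurable hUm)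
      (ae_restrict_of_forall_mem hUm fun x hx => ?_)
    have h0 := hρ0 x (hUΩ hx)
    rw [Real.norm_of_nonneg (by positivity)]
    simp only [Pi.add_apply]
    -- Where `v ≠ 0`, `v² ≤ 1 < (w / ε)²`, so the weighted square integrability of `B` and `u`
    -- passes to `v`.
    have hvle : v x ^ 2 ≤ 2 / ε ^ 2 * (B x ^ 2 + u x ^ 2) := by
      by_cases hwx : w x ≤ ε
      · rw [show v x = 0 from hGz _ hwx, zero_pow two_ne_zero]
        positivity
      · have h1 : v x ^ 2 ≤ 1 := pow_le_one₀ (hG0 _) (hG1 _)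
        have h2 : ε ^ 2 ≤ w x ^ 2 := pow_le_pow_left₀ hε.le (not_le.1 hwx).le 2
        have h3 : w x ^ 2 ≤ 2 * (B x ^ 2 + u x ^ 2) := by
          simp only [hw]; nlinarith [sq_nonneg (B x + u x)]
        rw [div_mul_eq_mul_div, le_div_iff₀ (by positivity)]
        nlinarith [sq_nonneg ε]
    nlinarith [mul_le_mul_of_nonneg_left hvle h0.le]
  -- The singularity of `∇ B` at `Z` is harmless: `G'(w)` vanishes on `V`, a neighborhood of all
  -- labels.
  have hGBsq : IntegrableOn (fun x => weight α L x * ρ x ^ 2 * ‖deriv G (w x) • ∇ B x‖ ^ 2) U := by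
    have hG'c : ContinuousOn (fun x => deriv G (w x)) U :=
      (hG.continuous_deriv le_rfl).comp_continuousOn hwU
    have := integrableOn_weight_norm_gradient_sq hU hKc hKU hBl
      ((hκU.mul (hG'c.pow 2)).mono hKU)
    refine integrableOn_of_tsupport (K := K) hUm (this.congr_fun (fun x _ => ?_)
      hKc.measurableSet) fun x hx => ?_
    · simp only [Pi.mul_apply, Pi.pow_apply]
      rw [norm_smul, mul_pow, Real.norm_eq_abs, sq_abs]
      ring
    · rw [hK, Set.mem_sdiff, not_and_or, not_not] at hx
      rcases hx with hx | hx
      · rw [hB, gradient_barrier_eq_zero hβ0 hc hs (not_le.1 hx)]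
        simp
      · simp [hhV x hx]
  have hhsq : IntegrableOn (fun x => weight α L x * ρ x ^ 2 * ‖h x‖ ^ 2) U := by
    refine Integrable.mono'
      ((hGBsq.const_mul 2).add (hmem.integrable_grad_sq.const_mul (2 * M ^ 2)))
      (hκm.mul (hhm.norm.pow 2)) (ae_restrict_of_forall_mem hUm fun x hx => ?_)
    have h0 := (hκ0 x hx).le
    rw [Real.norm_of_nonneg (by positivity)]
    simp only [Pi.add_apply]
    have h1 : ‖h x‖ ≤ ‖deriv G (w x) • ∇ B x‖ + M * ‖g x‖ := by
      simp only [hh, smul_sub]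
      refine (norm_sub_le _ _).trans (add_le_add_right ?_ _)
      rw [norm_smul, Real.norm_of_nonneg (hG'0 _)]
      gcongr
      exact hG'M _
    have h2 : ‖h x‖ ^ 2 ≤ 2 * ‖deriv G (w x) • ∇ B x‖ ^ 2 + 2 * M ^ 2 * ‖g x‖ ^ 2 := by
      have := pow_le_pow_left₀ (norm_nonneg _) h1 2
      nlinarith [sq_nonneg (‖deriv G (w x) • ∇ B x‖ - M * ‖g x‖)]
    nlinarith [mul_le_mul_of_nonneg_left h2 h0]
  have hρ0' : ∀ x ∈ U, 0 ≤ ρ x := fun x hx => (hρ0 x (hUΩ hx)).le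
  have huv : IntegrableOn (fun x => ρ x * u x * v x) U := integrableOn_mul_of_sq hUm hρ0'
    (((hρU.mul huU).mul hvU).aestronglyMeasurable hUm) hmem.integrable_sq hvsq
  have hBv : IntegrableOn (fun x => ρ x * B x * v x) U := integrableOn_mul_of_sq hUm hρ0'
    (((hρU.mul hBc.continuousOn).mul hvU).aestronglyMeasurable hUm) hBsq hvsq
  have hgh : IntegrableOn (fun x => weight α L x * ρ x ^ 2 * inner ℝ (g x) (h x)) U :=
    integrableOn_inner_of_norm_sq hUm (fun x hx => (hκ0 x hx).le) (hκm.mul (hgm.inner hhm))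
      hmem.integrable_grad_sq hhsq
  -- the equation and the subsolution property of the barrier
  have heq := htest v h ⟨hvh, hvsq, hhsq⟩ fun z hz => by
    filter_upwards [hVo.mem_nhds (hLV hz)] with x hx using hvV x hx
  have hsub := barrier_subsolution (L := L) (α := α) hU hZn (fun z hz hzU => hzU.2 (hZL hz))
    (hρ.mono hUΩ)
    (fun x hx => hρ0 x (hUΩ hx)) hη hηc hηU (fun x => (hη01 x).1) hvU (fun x => hG0 _) hvh hβ hβ0 hα
    hΛ hτ hs hsR hR1 hbound (fun x hx => hL x (hx.trans hsR))
    ((ae_restrict_iff' hUm).2 (hgrad.mono fun x hx hxU hxs =>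
      (norm_gradient_le_mul_norm_gradient_log (hρ0 x (hUΩ hxU))).trans
        (mul_le_mul_of_nonneg_left (hx (hxs.trans hsR)) (hρ0' x hxU))))
    (fun x hx => hτR x (hx.trans hsR))
    (fun x _ hvx hxs => hηK x ⟨hxs.le, fun hxV => hvx (hvV x hxV)⟩)
    (fun x _ hhx hxs => (hηK x ⟨hxs.le, fun hxV => hhx (by simp [hh, hhV x hxV])⟩).1) hBv
  obtain ⟨hBh, hsub⟩ := hsub
  have hnonneg : ∀ᵐ x ∂volume.restrict U,
      0 ≤ weight α L x * ρ x ^ 2 * inner ℝ (∇ B x) (h x)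
        - weight α L x * ρ x ^ 2 * inner ℝ (g x) (h x) := by
    refine ae_restrict_of_forall_mem hUm fun x hx => ?_
    rw [← mul_sub, ← inner_sub_left, real_inner_smul_right, real_inner_self_eq_norm_sq]
    exact mul_nonneg (hκ0 x hx).le (mul_nonneg (hG'0 _) (sq_nonneg _))
  have hτint : 0 ≤ τ * (∫ x in U, ρ x * B x * v x) - τ * ∫ x in U, ρ x * u x * v x := by
    rw [← mul_sub, ← integral_sub hBv huv]
    refine mul_nonneg hτ (setIntegral_nonneg hUm fun x hx => ?_)
    have h0 := hρ0' x hx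
    rw [show ρ x * B x * v x - ρ x * u x * v x = ρ x * (w x * v x) by simp only [hw]; ring]
    refine mul_nonneg h0 ?_
    by_cases hwx : w x ≤ ε
    · rw [show v x = 0 from hGz _ hwx, mul_zero]
    · exact mul_nonneg (hε.le.trans (not_le.1 hwx).le) (hG0 _)
  -- The equation, the subsolution inequality and `hτint` make the integral of `γ ρ² G'(w) |∇ B -
  -- g|²` nonpositive. Hence `G'(w)` or `∇ B - g` vanishes almost everywhere, and `h` with it.
  have hzero : ∀ᵐ x ∂volume.restrict U, h x = 0 := by
    have hInt0 : ∫ x in U, (weight α L x * ρ x ^ 2 * inner ℝ (∇ B x) (h x)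
        - weight α L x * ρ x ^ 2 * inner ℝ (g x) (h x)) = 0 := by
      refine le_antisymm ?_ (integral_nonneg_of_ae hnonneg)
      rw [integral_sub hBh hgh]
      linarith
    have := (integral_eq_zero_iff_of_nonneg_ae hnonneg (hBh.sub hgh)).1 hInt0
    filter_upwards [this, ae_restrict_mem hUm] with x hx hxU
    rw [Pi.zero_apply, ← mul_sub, ← inner_sub_left, real_inner_smul_right,
      real_inner_self_eq_norm_sq] at hx
    rcases mul_eq_zero.1 ((mul_eq_zero.1 hx).resolve_left (hκ0 x hxU).ne') with hx | hx
    · simp [hh, hx]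
    · rw [sq_eq_zero_iff, norm_eq_zero] at hx
      simp [hh, hx]
  -- The removed labels do not disconnect anything, even in dimension one, because `v` is zero on a
  -- full neighborhood of each.
  have hconst : ∀ x ∈ Ω, ∀ᶠ y in 𝓝 x, v y = v x := by
    intro x hx
    by_cases hxL : x ∈ L
    · filter_upwards [hVo.mem_nhds (hLV hxL)] with y hy
      rw [hvV y hy, hvV x (hLV hxL)]
    · exact hvh.eventually_eq_of_ae_zero hU hvU hzero ⟨hx, hxL⟩
  obtain ⟨z, hz, hxz⟩ := (infDist_lt_iff hZn').1 hx₀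
  have hball : ball z R ⊆ Ω := fun y hy => hRΩ y ((infDist_lt_iff hZn').2 ⟨z, hz, hy⟩)
  have hvx : v x₀ = 0 := by
    rw [eq_of_locally_const (convex_ball z R).isPreconnected (fun y hy => hconst y (hball hy))
      (mem_ball.2 hxz) (mem_ball_self hR)]
    exact hvV z (hLV (hZL hz))
  by_contra hcon
  have : ε < w x₀ := by simp only [hw]; linarith [not_le.1 hcon]
  exact (hGpos _ this).ne' hvx

/-- The lower bound for the solution near the labels of its class. -/
theorem solution_ge (hΩ : IsOpen Ω) (hLf : L.Finite) (hLΩ : L ⊆ Ω) (hZn : Z.Nonempty)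
    (hZL : (Z : Set 𝔼) ⊆ L) (hρ0 : ∀ x ∈ Ω, 0 < ρ x) (hρ : LocallyLipschitzOn Ω ρ)
    (hβ : 2 * β = α + 2 - d) (hβ0 : 0 < β) (hα : -1 < α)
    (hΛ : 0 ≤ Λ) (hτ : 0 ≤ τ) (hR1 : R ≤ 1)
    (hbound : 2 * Λ * R * (1 + R ^ α) + α * R ^ α ≤ β / 2)
    (hRΩ : ∀ x, infDist x (Z : Set 𝔼) < R → x ∈ Ω)
    (hL : ∀ x, infDist x (Z : Set 𝔼) < R → infDist x L = infDist x (Z : Set 𝔼))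
    (hgrad : ∀ᵐ x, infDist x (Z : Set 𝔼) < R → ‖∇ (fun y => Real.log (ρ y)) x‖ ≤ Λ)
    (hτR : ∀ x, infDist x (Z : Set 𝔼) < R → τ * R ^ (d : ℝ) ≤ 4 / 9 * β ^ 2 * ρ x)
    (hsol : IsSolution Ω L Z τ α ρ u) {x : 𝔼} (hx : infDist x (Z : Set 𝔼) < R) :
    1 - R ^ (-β) * infDist x (Z : Set 𝔼) ^ β ≤ u x := by
  have hR : 0 < R := infDist_nonneg.trans_lt hx
  -- The strict gap `s < R` kept the closed `s`-neighborhood of `Z` inside `Ω`; it is closed only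
  -- now, with `ε → 0` first and then `s → R`.
  have hs : ∀ s ∈ Ioo (infDist x (Z : Set 𝔼)) R,
      R ^ (-β) * (s ^ β - infDist x (Z : Set 𝔼) ^ β) ≤ u x := by
    intro s hs
    refine le_of_forall_pos_le_add fun ε hε => ?_
    rw [← barrier_eq hβ0 (Real.rpow_pos_of_pos hR _) hs.1.le]
    exact barrier_le_solution_add hΩ hLf hLΩ hZn hZL hρ0 hρ hβ hβ0 hα hΛ hτ
      (infDist_nonneg.trans_lt hs.1) hs.2 hR1 hε hbound hRΩ hL hgrad hτR hsol hx
  have hlim : Tendsto (fun s : ℝ => R ^ (-β) * (s ^ β - infDist x (Z : Set 𝔼) ^ β)) (𝓝[<] R)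
      (𝓝 (R ^ (-β) * (R ^ β - infDist x (Z : Set 𝔼) ^ β))) := by
    refine Tendsto.mono_left (ContinuousAt.tendsto ?_) nhdsWithin_le_nhds
    exact continuousAt_const.mul
      ((Real.continuousAt_rpow_const R β (Or.inl hR.ne')).sub continuousAt_const)
  have := le_of_tendsto hlim (Filter.mem_of_superset (Ioo_mem_nhdsLT hx) hs)
  rwa [mul_sub, ← Real.rpow_add hR, neg_add_cancel, Real.rpow_zero] at this

end SolutionBound

end ActiveLearning

end

/-! ### The main theorem: parameters and hypotheses for one class -/

open Metric in
theorem theorem4p2 {d C : ℕ} (Ω : Set (EuclideanSpace ℝ (Fin d))) (hΩ : IsOpen Ω)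
    -- the density
    (ρ : EuclideanSpace ℝ (Fin d) → ℝ) (hρ_pos : ∀ x ∈ Ω, 0 < ρ x)
    (hρ_lip : LocallyLipschitzOn Ω ρ)
    -- the classes and the labels
    (cls L : Fin C → Set (EuclideanSpace ℝ (Fin d)))
    (hL_fin : ∀ i, (L i).Finite) (hL : ∀ i, L i ⊆ cls i)
    (τ α r : ℝ) (hτ : 0 ≤ τ) (hα : (d : ℝ) - 2 < α) (hr : 0 < r)
    -- the solutions of the continuum equations
    (u : Fin C → EuclideanSpace ℝ (Fin d) → ℝ)
    (hu : ∀ i, ActiveLearning.IsSolution Ω (⋃ j, L j) (L i) τ α ρ (u i))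
    -- the conditions on `r`
    (hr_dom : (⋃ i, cls i) + Metric.ball 0 (2 * r) ⊆ Ω)
    (hr_one : d = 1 → 2 * r ≤ 1)
    (hr_sep : ENNReal.ofReal r ≤ ActiveLearning.separation cls / 4)
    (hr_tau : τ * r ^ d ≤ 1 / (2 ^ d * 9) * (α + 2 - d) ^ 2 *
      sInf (ρ '' ((⋃ i, cls i) + Metric.ball 0 (2 * r))))
    (hr_mem : MemLp (∇ fun x => Real.log (ρ x)) ∞
      (volume.restrict ((⋃ i, cls i) + Metric.ball 0 (2 * r))))
    (hr_grad : 4 * (eLpNorm (∇ fun x => Real.log (ρ x)) ∞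
        (volume.restrict ((⋃ i, cls i) + Metric.ball 0 (2 * r)))).toReal
          * (1 + 2 ^ α * r ^ α) * r + α * 2 ^ α * r ^ α ≤ 1 / 4 * (α + 2 - d)) :
    ∀ x ∈ (⋃ i, L i) + Metric.ball 0 r,
      1 - (2 : ℝ) ^ (-(1 / 2) * (α + 2 - d)) ≤ ActiveLearning.acquisition u x := by
  set T : Set (EuclideanSpace ℝ (Fin d)) := (⋃ i, cls i) + ball 0 (2 * r) with hT
  set Λ : ℝ := (eLpNorm (∇ fun x => Real.log (ρ x)) ∞ (volume.restrict T)).toReal with hΛ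
  intro x hx
  obtain ⟨z, hz, b, hb, rfl⟩ := Set.mem_add.1 hx
  obtain ⟨i, hzi⟩ := mem_iUnion.1 hz
  -- it suffices to bound the component belonging to the class of `z`
  suffices hui : 1 - (2 : ℝ) ^ (-(1 / 2) * (α + 2 - d)) ≤ u i (z + b) by
    refine hui.trans ((le_abs_self _).trans ?_)
    rw [← Real.sqrt_sq_eq_abs]
    exact Real.sqrt_le_sqrt (Finset.single_le_sum (f := fun i => u i (z + b) ^ 2)
      (fun j _ => sq_nonneg _) (Finset.mem_univ i))
  -- In dimension zero the space is a single point, the label itself. Otherwise `d ≥ 1` gives `α >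
  -- -1`.
  rcases Nat.eq_zero_or_pos d with hd | hd
  · subst hd
    rw [show z + b = z from Subsingleton.elim _ _, (hu i).eq_one z hzi]
    linarith [Real.rpow_pos_of_pos two_pos (-(1 / 2) * (α + 2 - ((0 : ℕ) : ℝ)))]
  have hd1 : (1 : ℝ) ≤ d := by exact_mod_cast hd
  set β : ℝ := (α + 2 - d) / 2 with hβdef
  have hβ0 : 0 < β := by rw [hβdef]; linarith
  have hΛ0 : 0 ≤ Λ := ENNReal.toReal_nonneg
  have hpow : (2 * r) ^ α = 2 ^ α * r ^ α := Real.mul_rpow two_pos.le hr.le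
  have hbound : 2 * Λ * (2 * r) * (1 + (2 * r) ^ α) + α * (2 * r) ^ α ≤ β / 2 := by
    rw [hpow, hβdef]; linarith
  -- For `d ≥ 2`, `2r > 1` would give `α (2r)^α ≥ α`, while the gradient condition bounds this by `β
  -- / 2 ≤ α / 4`.
  have hR1 : 2 * r ≤ 1 := by
    rcases Nat.lt_or_ge 1 d with hd2 | hd2
    · by_contra hcon
      have hd2' : (2 : ℝ) ≤ d := by exact_mod_cast hd2
      have hα0 : 0 < α := by linarith
      have h1 : 1 ≤ (2 * r) ^ α := Real.one_le_rpow (not_le.1 hcon).le hα0.le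
      have h2 : 0 ≤ 2 * Λ * (2 * r) * (1 + (2 * r) ^ α) := by positivity
      have h3 : β ≤ α / 2 := by rw [hβdef]; linarith
      nlinarith [mul_le_mul_of_nonneg_left h1 hα0.le]
    · exact hr_one (le_antisymm hd2 hd)
  set Z := (hL_fin i).toFinset with hZdef
  have hZ : (Z : Set (EuclideanSpace ℝ (Fin d))) = L i := (hL_fin i).coe_toFinset
  have hLn : (L i).Nonempty := ⟨z, hzi⟩
  have hLT : ∀ y, infDist y (L i) < 2 * r → y ∈ T := by
    intro y hy
    obtain ⟨z', hz', hyz⟩ := (infDist_lt_iff hLn).1 hy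
    exact Set.mem_add.2 ⟨z', mem_iUnion.2 ⟨i, hL i hz'⟩, y - z',
      by rwa [mem_ball_zero_iff, ← dist_eq_norm], add_sub_cancel _ _⟩
  have hsep : ∀ j, j ≠ i → ∀ a ∈ L i, ∀ y ∈ L j, 4 * r ≤ dist a y := by
    intro j hj a ha y hy
    have h1 : ActiveLearning.separation cls ≤ edist a y :=
      (iInf_le_of_le i <| iInf_le_of_le j <| iInf_le_of_le (Ne.symm hj) <|
        iInf₂_le_of_le a (hL i ha) <| iInf₂_le y (hL j hy))
    have h2 : ENNReal.ofReal r * 4 ≤ edist a y :=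
      ((ENNReal.le_div_iff_mul_le (by simp) (by simp)).1 hr_sep).trans h1
    rw [edist_dist, show (4 : ℝ≥0∞) = ENNReal.ofReal 4 by simp,
      ← ENNReal.ofReal_mul hr.le, ENNReal.ofReal_le_ofReal_iff dist_nonneg] at h2
    linarith
  -- Labels of other classes are at least `4r` from `L i`, hence more than `2r` from a point closer
  -- than `2r` to `L i`.
  have hinf : ∀ y, infDist y (L i) < 2 * r → infDist y (⋃ j, L j) = infDist y (L i) := by
    intro y hy
    refine le_antisymm (infDist_le_infDist_of_subset (subset_iUnion L i) hLn)
      ((le_infDist (hLn.mono (subset_iUnion L i))).2 fun {q} hq => ?_)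
    obtain ⟨j, hqj⟩ := mem_iUnion.1 hq
    by_cases hj : j = i
    · exact infDist_le_dist_of_mem (hj ▸ hqj)
    · obtain ⟨a, ha, hya⟩ := (infDist_lt_iff hLn).1 hy
      have h1 := hsep j hj a ha q hqj
      have h2 := dist_triangle_left a q y
      linarith
  have hgrad : ∀ᵐ y, infDist y (L i) < 2 * r → ‖∇ (fun y => Real.log (ρ y)) y‖ ≤ Λ := by
    have hTo : IsOpen T := isOpen_ball.add_left
    have h1 : ∀ᵐ y ∂volume.restrict T, ‖∇ (fun y => Real.log (ρ y)) y‖ ≤ Λ := by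
      filter_upwards [ae_le_eLpNormEssSup (μ := volume.restrict T)
        (f := ∇ fun x => Real.log (ρ x))] with y hy
      rw [← eLpNorm_exponent_top] at hy
      rw [hΛ, ← toReal_enorm]
      -- Finiteness of the norm matters: an infinite one would have `toReal` equal to `0`.
      exact ENNReal.toReal_mono hr_mem.eLpNorm_lt_top.ne hy
    filter_upwards [(ae_restrict_iff' hTo.measurableSet).1 h1] with y hy hyL using hy (hLT y hyL)
  have hτR : ∀ y, infDist y (L i) < 2 * r → τ * (2 * r) ^ (d : ℝ) ≤ 4 / 9 * β ^ 2 * ρ y := by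
    intro y hy
    have hbdd : BddBelow (ρ '' T) :=
      ⟨0, by rintro _ ⟨q, hq, rfl⟩; exact (hρ_pos q (hr_dom hq)).le⟩
    have h1 : sInf (ρ '' T) ≤ ρ y := csInf_le hbdd (mem_image_of_mem ρ (hLT y hy))
    rw [Real.rpow_natCast, mul_pow]
    -- The factor `2^d` from `R = 2r` cancels, and `(α+2-d)² = 4β²` gives the constant `4/9`.
    calc τ * (2 ^ d * r ^ d) = 2 ^ d * (τ * r ^ d) := by ring
      _ ≤ 2 ^ d * (1 / (2 ^ d * 9) * (α + 2 - d) ^ 2 * sInf (ρ '' T)) := by gcongr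
      _ = 4 / 9 * β ^ 2 * sInf (ρ '' T) := by rw [hβdef]; field_simp; ring
      _ ≤ 4 / 9 * β ^ 2 * ρ y := by gcongr
  have hLf : (⋃ j, L j).Finite := finite_iUnion hL_fin
  have hLΩ : (⋃ j, L j) ⊆ Ω := by
    refine iUnion_subset fun j y hy => hr_dom (Set.mem_add.2 ⟨y, mem_iUnion.2 ⟨j, hL j hy⟩, 0, ?_,
      add_zero y⟩)
    exact mem_ball_self (by linarith)
  have hxr : infDist (z + b) (L i) < r :=
    (infDist_lt_iff hLn).2 ⟨z, hzi, by simpa [dist_eq_norm] using hb⟩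
  have hmain := ActiveLearning.solution_ge (Z := Z) (β := β) hΩ hLf hLΩ
    ((hL_fin i).toFinset_nonempty.2 hLn) (by rw [hZ]; exact subset_iUnion L i) hρ_pos hρ_lip
    (by rw [hβdef]; ring) hβ0 (by linarith) hΛ0 hτ hR1 hbound
    (by rw [hZ]; exact fun y hy => hr_dom (hLT y hy)) (by rwa [hZ]) (by rwa [hZ]) (by rwa [hZ])
    (by rw [hZ]; exact hu i) (x := z + b) (by rw [hZ]; linarith)
  refine le_trans ?_ hmain
  rw [hZ]
  have h1 : infDist (z + b) (L i) ^ β ≤ r ^ β := Real.rpow_le_rpow infDist_nonneg hxr.le hβ0.le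
  have h2 : (2 * r) ^ (-β) * infDist (z + b) (L i) ^ β ≤ 2 ^ (-(1 / 2) * (α + 2 - d)) := by
    calc (2 * r) ^ (-β) * infDist (z + b) (L i) ^ β ≤ (2 * r) ^ (-β) * r ^ β := by gcongr
      _ = 2 ^ (-β) := by
        rw [Real.mul_rpow two_pos.le hr.le, mul_assoc, ← Real.rpow_add hr, neg_add_cancel,
          Real.rpow_zero, mul_one]
      _ = 2 ^ (-(1 / 2) * (α + 2 - d)) := by congr 1; rw [hβdef]; ring
  linarith
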